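/- Let $s\in[-\frac12,1]$, $s\neq 0$, be fixed. For $\delta>1$ let $$S_\delta=\{x_1^2+(x_2-\delta)^2<1\}\cup\{x_1^2+(x_2+\delta)^2<1\}\cup\{|x_1|<1,\ |x_2|\le\delta\}\subset\mathbb{R}^2$$ be the stadium, and let $$M_\delta=S_\delta\setminus\left(\{x_1^2+(x_2-\delta)^2\le\tfrac12\}\cup\{x_1^2+(x_2+\delta)^2\le\tfrac12\}\right)$$ be the stadium with two holes, whose outer boundary is $\partial S_\delta$. Let $\tau_\delta:\partial S_\delta\to\mathbb{S}^1\subset\mathbb{R}^2$ be the unit tangent of $\partial S_\delta$, oriented clockwise or anticlockwise (one of the two is chosen). For a unit vector $m=(m_1,m_2)$ put $P(m)=s\left((m_1,m_2,0)\otimes(m_1,m_2,0)-\frac13\mathrm{Id}\right)$, and let $\mathcal{Q}_2=\{P(m):m\in\mathbb{S}^1\}\subset\mathbb{R}^{3\times3}$. Consider the class $\mathcal{A}_\delta$ of line fields $Q\in W^{1,2}(M_\delta;\mathcal{Q}_2)$ with trace $Q=P(\tau_\delta)$ on $\partial S_\delta$, and the class $\mathcal{B}_\delta$ of vector fields $n\in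 W^{1,2}(M_\delta;\mathbb{S}^1)$ with trace $n=\tau_\delta$ on $\partial S_\delta$, with the energies $$E_\delta(Q)=\int_{M_\delta}|\nabla Q|^2\,dx\quad(Q\in\mathcal{A}_\delta),\qquad F_\delta(n)=2s^2\int_{M_\delta}|\nabla n|^2\,dx\quad(n\in\mathcal{B}_\delta).$$ Then there exists $\delta_0>1$ such that for every $\delta>\delta_0$, and for either orientation of $\tau_\delta$, both classes are non-empty, $$\inf_{\mathcal{A}_\delta}E_\delta<\inf_{\mathcal{B}_\delta}F_\delta,$$ and hence $E_\delta(\bar Q_\delta)<F_\delta(\bar n_\delta)$ for any global minimizer $\bar Q_\delta$ of $E_\delta$ in $\mathcal{A}_\delta$ and any global minimizer $\bar n_\delta$ of $F_\delta$ in $\mathcal{B}_\delta$. -/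

import Mathlib

open MeasureTheory Filter Topology
open scoped ContDiff

noncomputable section

namespace LineField

/-- The plane `ℝ²` with its Euclidean norm; `x 0` is the coordinate `x₁`, `x 1` is `x₂`. -/
abbrev Plane := EuclideanSpace ℝ (Fin 2)

/-! ### Sobolev functions -/

/-- `g` is the weak partial derivative `∂u/∂xᵢ` in the open set `U`. -/
def IsWeakPartial (U : Set Plane) (i : Fin 2) (u g : Plane → ℝ) : Prop :=
  LocallyIntegrableOn u U ∧ LocallyIntegrableOn g U ∧
    ∀ φ : Plane → ℝ, ContDiff ℝ ∞ φ → HasCompactSupport φ → tsupport φ ⊆ U →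
      ∫ x in U, u x * fderiv ℝ φ x (EuclideanSpace.single i 1) = -∫ x in U, g x * φ x

open Classical in
/-- The weak partial derivative (unique almost everywhere in `U`), if there is one. -/
def weakPartial (U : Set Plane) (i : Fin 2) (u : Plane → ℝ) : Plane → ℝ :=
  if h : ∃ g, IsWeakPartial U i u g then h.choose else 0

/-- `u ∈ W^{1,2}(U)`. -/
def MemW12 (U : Set Plane) (u : Plane → ℝ) : Prop :=
  MemLp u 2 (volume.restrict U) ∧
    ∀ i, ∃ g, IsWeakPartial U i u g ∧ MemLp g 2 (volume.restrict U)

/-- The Dirichlet integral `∫_U |∇f|² dx` of a field with finitely many real components. -/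
def dirichlet {ι : Type*} [Fintype ι] (U : Set Plane) (f : Plane → ι → ℝ) : ℝ :=
  ∫ x in U, ∑ a, ∑ i, (weakPartial U i (fun y => f y a) x) ^ 2

/-- `v k → u` in `W^{1,2}(U)`. -/
def TendstoW12 (U : Set Plane) (v : ℕ → Plane → ℝ) (u : Plane → ℝ) : Prop :=
  Tendsto (fun k => eLpNorm (v k - u) 2 (volume.restrict U)) atTop (𝓝 0) ∧
    ∀ i, Tendsto (fun k => eLpNorm (weakPartial U i (v k - u)) 2 (volume.restrict U))
      atTop (𝓝 0)

/-- The trace of `u ∈ W^{1,2}(U)` on the part `Γ` of the boundary of `U` is `φ`. The trace operator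
is the continuous extension to `W^{1,2}(U)` of the restriction `v ↦ v|_Γ`, with values in
`L²(Γ)` for the one-dimensional Hausdorff measure, defined for `v ∈ W^{1,2}(U) ∩ C(closure U)`. -/
def HasTrace (U Γ : Set Plane) (u φ : Plane → ℝ) : Prop :=
  ∃ v : ℕ → Plane → ℝ, (∀ k, MemW12 U (v k) ∧ ContinuousOn (v k) (closure U)) ∧
    TendstoW12 U v u ∧
    Tendsto (fun k => eLpNorm (v k - φ) 2 ((Measure.hausdorffMeasure 1).restrict Γ))
      atTop (𝓝 0)

/-! ### The stadium with two holes -/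

/-- The open disc `M₁`. -/
def M₁ (δ : ℝ) : Set Plane := {x | x 0 ^ 2 + (x 1 - δ) ^ 2 < 1}

/-- The open disc `M₂`. -/
def M₂ (δ : ℝ) : Set Plane := {x | x 0 ^ 2 + (x 1 + δ) ^ 2 < 1}

/-- The rectangle `M₃`. -/
def M₃ (δ : ℝ) : Set Plane := {x | |x 0| < 1 ∧ |x 1| ≤ δ}

/-- The hole `M₄`. -/
def M₄ (δ : ℝ) : Set Plane := {x | x 0 ^ 2 + (x 1 - δ) ^ 2 ≤ 1 / 2}

/-- The hole `M₅`. -/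
def M₅ (δ : ℝ) : Set Plane := {x | x 0 ^ 2 + (x 1 + δ) ^ 2 ≤ 1 / 2}

/-- The stadium without holes. -/
def fullStadium (δ : ℝ) : Set Plane := M₁ δ ∪ M₂ δ ∪ M₃ δ

/-- The domain `M_δ`. -/
def stadium (δ : ℝ) : Set Plane := fullStadium δ \ (M₄ δ ∪ M₅ δ)

/-- The outer boundary of `M_δ`. -/
def outerBoundary (δ : ℝ) : Set Plane := frontier (fullStadium δ)

/-- On the outer boundary, the clockwise unit tangent: the point of the segment `{0} × [-δ, δ]`
nearest to `x` is `(0, max (-δ) (min δ x₂))`, the difference of `x` and this point is the outer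
unit normal `(ν₁, ν₂)`, and the tangent is `(ν₂, -ν₁)`. So it is `(x₂ - δ, -x₁)` on the upper
arc, `(x₂ + δ, -x₁)` on the lower arc, `(0, -1)` on the right side, `(0, 1)` on the left side. -/
def clockwiseTangent (δ : ℝ) (x : Plane) : Plane :=
  !₂[x 1 - max (-δ) (min δ (x 1)), -x 0]

/-! ### Line fields, vector fields and their energies -/

/-- The matrix `s (m ⊗ m - Id / 3)` with `m = (n₁, n₂, 0)`. -/
def lineTensor (s : ℝ) (n : Plane) : Matrix (Fin 3) (Fin 3) ℝ :=
  s • (Matrix.vecMulVec ![n 0, n 1, 0] ![n 0, n 1, 0] - (1 / 3 : ℝ) • 1)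

/-- The set `𝒬₂` of planar line tensors. -/
def Q₂ (s : ℝ) : Set (Matrix (Fin 3) (Fin 3) ℝ) := {Q | ∃ n : Plane, ‖n‖ = 1 ∧ Q = lineTensor s n}

/-- The fields `Q ∈ W^{1,2}(M_δ; 𝒬₂)` whose trace on the outer boundary is the tangent
line field. -/
def tangentLineFields (s δ : ℝ) : Set (Plane → Matrix (Fin 3) (Fin 3) ℝ) :=
  {Q | (∀ a b, MemW12 (stadium δ) fun x => Q x a b) ∧
    (∀ᵐ x ∂volume.restrict (stadium δ), Q x ∈ Q₂ s) ∧
    ∀ a b, HasTrace (stadium δ) (outerBoundary δ) (fun x => Q x a b)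
      (fun x => lineTensor s (clockwiseTangent δ x) a b)}

/-- The fields `n ∈ W^{1,2}(M_δ; 𝕊¹)` whose trace on the outer boundary is `σ` times the clockwise
unit tangent: `σ = 1` is the clockwise and `σ = -1` the anticlockwise orientation. -/
def tangentVectorFields (δ σ : ℝ) : Set (Plane → Plane) :=
  {n | (∀ a, MemW12 (stadium δ) fun x => n x a) ∧
    (∀ᵐ x ∂volume.restrict (stadium δ), ‖n x‖ = 1) ∧
    ∀ a, HasTrace (stadium δ) (outerBoundary δ) (fun x => n x a)
      (fun x => σ * clockwiseTangent δ x a)}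

/-- `∫_{M_δ} |∇Q|² dx`, with the Frobenius norm. -/
def lineEnergy (δ : ℝ) (Q : Plane → Matrix (Fin 3) (Fin 3) ℝ) : ℝ :=
  dirichlet (stadium δ) fun x (p : Fin 3 × Fin 3) => Q x p.1 p.2

/-- `2 s² ∫_{M_δ} |∇n|² dx`. -/
def vectorEnergy (s δ : ℝ) (n : Plane → Plane) : ℝ :=
  2 * s ^ 2 * dirichlet (stadium δ) fun x (a : Fin 2) => n x a

end LineField

end

/-!
A line field does not see the orientation of the tangent. On the straight part `|x₂| ≤ δ` of the
stadium the boundary values of `Q` are therefore constant, `P(±e₂)`, and `Q` can be constant there: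
only the two caps cost energy, and the infimum over line fields is bounded uniformly in `δ`.

A vector field has the boundary values `-σ e₂` on the right side and `σ e₂` on the left side. The
divergence theorem on the rectangle `(-1, 1) × (-(δ - 1), δ - 1)`, which avoids the holes, gives
`∫ ∂₁n₂ = -4 σ (δ - 1)`, so `∫ |∇n|² ≥ 4 (δ - 1)` by the Cauchy–Schwarz inequality, and the
infimum over vector fields grows linearly in `δ`.
-/

namespace LineField

/-! ### Test functions -/

section TestFunctions

variable {E : Type*} [NormedAddCommGroup E] [NormedSpace ℝ E] {U V : Set E} {φ ψ g : E → ℝ}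

/-- `φ` is a test function in `U`: smooth, with compact support contained in `U`. It is the
predicate that the weak derivatives of `IsWeakPartial` are tested against. -/
structure IsTestFunction (U : Set E) (φ : E → ℝ) : Prop where
  contDiff : ContDiff ℝ ∞ φ
  hasCompactSupport : HasCompactSupport φ
  tsupport_subset : tsupport φ ⊆ U

namespace IsTestFunction

theorem mono (hφ : IsTestFunction U φ) (h : U ⊆ V) : IsTestFunction V φ :=
  ⟨hφ.contDiff, hφ.hasCompactSupport, hφ.tsupport_subset.trans h⟩

theorem eq_zero_of_notMem (hφ : IsTestFunction U φ) {x : E} (hx : x ∉ U) : φ x = 0 :=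
  image_eq_zero_of_notMem_tsupport fun h => hx (hφ.tsupport_subset h)

theorem fderiv_apply (hφ : IsTestFunction U φ) (v : E) :
    IsTestFunction U fun x => fderiv ℝ φ x v :=
  ⟨(hφ.contDiff.fderiv_right (m := ∞) (by simp)).clm_apply contDiff_const,
    hφ.hasCompactSupport.fderiv_apply ℝ v,
    (tsupport_fderiv_apply_subset ℝ v).trans hφ.tsupport_subset⟩

theorem sub (hφ : IsTestFunction U φ) (hψ : IsTestFunction U ψ) : IsTestFunction U (φ - ψ) :=
  ⟨hφ.contDiff.sub hψ.contDiff, hφ.hasCompactSupport.sub hψ.hasCompactSupport,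
    (tsupport_sub _ _).trans (Set.union_subset hφ.tsupport_subset hψ.tsupport_subset)⟩

theorem const_smul (hφ : IsTestFunction U φ) (c : ℝ) : IsTestFunction U (c • φ) :=
  ⟨contDiff_const.smul hφ.contDiff, hφ.hasCompactSupport.smul_left,
    (closure_mono (Function.support_const_smul_subset c φ)).trans hφ.tsupport_subset⟩

variable [MeasurableSpace E] {μ : Measure E}

theorem integrable [OpensMeasurableSpace E] [IsFiniteMeasureOnCompacts μ]
    (hφ : IsTestFunction U φ) : Integrable φ μ :=
  hφ.contDiff.continuous.integrable_of_hasCompactSupport hφ.hasCompactSupport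

theorem setIntegral_mul (hφ : IsTestFunction U φ) (g : E → ℝ) :
    ∫ x in U, g x * φ x ∂μ = ∫ x, g x * φ x ∂μ :=
  setIntegral_eq_integral_of_forall_compl_eq_zero fun x hx => by
    rw [hφ.eq_zero_of_notMem hx, mul_zero]

theorem integrable_mul [OpensMeasurableSpace E] (hφ : IsTestFunction U φ)
    (hg : LocallyIntegrableOn g U μ) : Integrable (fun x => g x * φ x) μ := by
  have hgφ : IntegrableOn (fun x => g x * φ x) (tsupport φ) μ :=
    (hg.integrableOn_compact_subset hφ.tsupport_subset hφ.hasCompactSupport).mul_continuousOn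
      hφ.contDiff.continuous.continuousOn hφ.hasCompactSupport
  exact (integrableOn_iff_integrable_of_support_subset fun x hx =>
    subset_tsupport φ (right_ne_zero_of_mul hx)).1 hgφ

end IsTestFunction

theorem ae_eq_zero_of_integral_mul_isTestFunction [FiniteDimensional ℝ E] [MeasurableSpace E]
    [BorelSpace E] {μ : Measure E} (hU : IsOpen U) (hg : LocallyIntegrableOn g U μ)
    (h : ∀ φ, IsTestFunction U φ → ∫ x, g x * φ x ∂μ = 0) : ∀ᵐ x ∂μ, x ∈ U → g x = 0 :=
  hU.ae_eq_zero_of_integral_contDiff_smul_eq_zero hg fun φ hφ hφc hφU => by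
    simpa only [smul_eq_mul, mul_comm] using h φ ⟨hφ, hφc, hφU⟩

end TestFunctions

/-! ### Weak partial derivatives -/

section WeakPartial

variable {U V : Set Plane} {i : Fin 2} {u u' g g' : Plane → ℝ}

namespace IsWeakPartial

theorem integral_mul_fderiv (h : IsWeakPartial U i u g) {φ : Plane → ℝ}
    (hφ : IsTestFunction U φ) :
    ∫ x, u x * fderiv ℝ φ x (EuclideanSpace.single i 1) = -∫ x, g x * φ x := by
  rw [← (hφ.fderiv_apply _).setIntegral_mul, ← hφ.setIntegral_mul]
  exact h.2.2 φ hφ.contDiff hφ.hasCompactSupport hφ.tsupport_subset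

theorem of_integral_mul_fderiv (hu : LocallyIntegrableOn u U) (hg : LocallyIntegrableOn g U)
    (h : ∀ φ, IsTestFunction U φ →
      ∫ x, u x * fderiv ℝ φ x (EuclideanSpace.single i 1) = -∫ x, g x * φ x) :
    IsWeakPartial U i u g := by
  refine ⟨hu, hg, fun φ hφ hφc hφU => ?_⟩
  have hφ' : IsTestFunction U φ := ⟨hφ, hφc, hφU⟩
  rw [(hφ'.fderiv_apply _).setIntegral_mul, hφ'.setIntegral_mul, h φ hφ']

theorem mono (h : IsWeakPartial U i u g) (hVU : V ⊆ U) : IsWeakPartial V i u g :=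
  of_integral_mul_fderiv (h.1.mono_set hVU) (h.2.1.mono_set hVU) fun _ hφ =>
    h.integral_mul_fderiv (hφ.mono hVU)

theorem sub (h : IsWeakPartial U i u g) (h' : IsWeakPartial U i u' g') :
    IsWeakPartial U i (u - u') (g - g') := by
  refine of_integral_mul_fderiv (h.1.sub h'.1) (h.2.1.sub h'.2.1) fun φ hφ => ?_
  simp only [Pi.sub_apply, sub_mul]
  rw [integral_sub ((hφ.fderiv_apply _).integrable_mul h.1)
      ((hφ.fderiv_apply _).integrable_mul h'.1),
    integral_sub (hφ.integrable_mul h.2.1) (hφ.integrable_mul h'.2.1),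
    h.integral_mul_fderiv hφ, h'.integral_mul_fderiv hφ]
  ring

theorem ae_eq (hU : IsOpen U) (h : IsWeakPartial U i u g) (h' : IsWeakPartial U i u g') :
    g =ᵐ[volume.restrict U] g' := by
  have hzero : ∀ᵐ x, x ∈ U → (g - g') x = 0 := by
    refine ae_eq_zero_of_integral_mul_isTestFunction hU (h.2.1.sub h'.2.1) fun φ hφ => ?_
    simp only [Pi.sub_apply, sub_mul]
    rw [integral_sub (hφ.integrable_mul h.2.1) (hφ.integrable_mul h'.2.1), sub_eq_zero, ← neg_inj,
      ← h.integral_mul_fderiv hφ, h'.integral_mul_fderiv hφ]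
  rw [Filter.EventuallyEq, ae_restrict_iff' hU.measurableSet]
  filter_upwards [hzero] with x hx hxU using sub_eq_zero.1 (hx hxU)

theorem isWeakPartial_weakPartial (h : IsWeakPartial U i u g) :
    IsWeakPartial U i u (weakPartial U i u) := by
  have hex : ∃ g, IsWeakPartial U i u g := ⟨g, h⟩
  rw [weakPartial, dif_pos hex]
  exact hex.choose_spec

theorem weakPartial_ae_eq (hU : IsOpen U) (h : IsWeakPartial U i u g) :
    weakPartial U i u =ᵐ[volume.restrict U] g :=
  h.isWeakPartial_weakPartial.ae_eq hU h

end IsWeakPartial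

theorem MemW12.isWeakPartial (h : MemW12 U u) (i : Fin 2) :
    IsWeakPartial U i u (weakPartial U i u) :=
  (h.2 i).choose_spec.1.isWeakPartial_weakPartial

theorem MemW12.memLp_weakPartial (hU : IsOpen U) (h : MemW12 U u) (i : Fin 2) :
    MemLp (weakPartial U i u) 2 (volume.restrict U) :=
  let ⟨_, hg, hg2⟩ := h.2 i
  hg2.ae_eq (hg.weakPartial_ae_eq hU).symm

theorem MemW12.weakPartial_sub_ae_eq (hU : IsOpen U) (h : MemW12 U u) (h' : MemW12 U u')
    (i : Fin 2) : weakPartial U i (u - u') =ᵐ[volume.restrict U]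
      weakPartial U i u - weakPartial U i u' :=
  ((h.isWeakPartial i).sub (h'.isWeakPartial i)).weakPartial_ae_eq hU

theorem MemW12.hasTrace_of_continuousOn (hU : IsOpen U) {Γ : Set Plane} (hΓ : MeasurableSet Γ)
    (hu : MemW12 U u) (hc : ContinuousOn u (closure U)) {φ : Plane → ℝ}
    (hφ : Set.EqOn u φ Γ) : HasTrace U Γ u φ := by
  refine ⟨fun _ => u, fun _ => ⟨hu, hc⟩, ⟨by simp, fun i => ?_⟩, ?_⟩
  · have hzero := hu.weakPartial_sub_ae_eq hU hu i
    rw [sub_self (weakPartial U i u)] at hzero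
    simp only [eLpNorm_congr_ae hzero, eLpNorm_zero, tendsto_const_nhds]
  · have hzero : u - φ =ᵐ[(Measure.hausdorffMeasure 1).restrict Γ] 0 :=
      (ae_restrict_iff' hΓ).2 (.of_forall fun x hx => sub_eq_zero.2 (hφ hx))
    simp only [eLpNorm_congr_ae hzero, eLpNorm_zero, tendsto_const_nhds]

theorem dirichlet_nonneg {ι : Type*} [Fintype ι] (U : Set Plane) (f : Plane → ι → ℝ) :
    0 ≤ dirichlet U f :=
  integral_nonneg fun _ => Finset.sum_nonneg fun _ _ => Finset.sum_nonneg fun _ _ => sq_nonneg _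

end WeakPartial

/-! ### Lipschitz functions -/

section Lipschitz

open scoped NNReal

theorem lipschitzWith_apply (i : Fin 2) : LipschitzWith 1 fun x : Plane => x i :=
  (EuclideanSpace.proj (𝕜 := ℝ) i).lipschitz.weaken <| by
    rw [← NNReal.coe_le_coe]
    exact ContinuousLinearMap.opNorm_le_bound _ zero_le_one fun x => by
      simpa using PiLp.norm_apply_le x i

theorem lipschitzWith_mul_of_norm_le_one {α R : Type*} [PseudoMetricSpace α]
    [SeminormedRing R] {f g : α → R} {C D : ℝ≥0} (hf : LipschitzWith C f) (hg : LipschitzWith D g)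
    (hf1 : ∀ x, ‖f x‖ ≤ 1) (hg1 : ∀ x, ‖g x‖ ≤ 1) :
    LipschitzWith (C + D) fun x => f x * g x := by
  refine LipschitzWith.of_dist_le_mul fun x y => ?_
  calc dist (f x * g x) (f y * g y)
      = ‖(f x - f y) * g x + f y * (g x - g y)‖ := by rw [dist_eq_norm]; congr 1; noncomm_ring
    _ ≤ ‖f x - f y‖ * ‖g x‖ + ‖f y‖ * ‖g x - g y‖ :=
      (norm_add_le _ _).trans (add_le_add (norm_mul_le _ _) (norm_mul_le _ _))
    _ ≤ C * dist x y * 1 + 1 * (D * dist x y) := by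
      rw [← dist_eq_norm, ← dist_eq_norm]
      gcongr
      exacts [hf.dist_le_mul x y, hg1 x, hf1 y, hg.dist_le_mul x y]
    _ = (C + D : ℝ≥0) * dist x y := by push_cast; ring

variable {U S : Set Plane} {C : ℝ≥0} {u : Plane → ℝ}

theorem abs_lineDeriv_single_le (hu : LipschitzWith C u) (i : Fin 2) (x : Plane) :
    |lineDeriv ℝ u x (EuclideanSpace.single i 1)| ≤ C := by
  simpa using norm_lineDeriv_le_of_lipschitz (𝕜 := ℝ) (x₀ := x)
    (v := EuclideanSpace.single i 1) hu

theorem isWeakPartial_lineDeriv (hu : LipschitzWith C u) (i : Fin 2) :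
    IsWeakPartial U i u fun x => lineDeriv ℝ u x (EuclideanSpace.single i 1) := by
  refine .of_integral_mul_fderiv (hu.continuous.locallyIntegrable.locallyIntegrableOn U)
    ((hu.locallyIntegrable_lineDeriv _).locallyIntegrableOn U) fun φ hφ => ?_
  obtain ⟨D, hD⟩ := ContDiff.lipschitzWith_of_hasCompactSupport hφ.hasCompactSupport
    hφ.contDiff (by simp)
  rw [hu.integral_lineDeriv_mul_eq hD hφ.hasCompactSupport, ← integral_neg]
  refine integral_congr_ae (.of_forall fun x => ?_)
  simp only [(hφ.contDiff.differentiable (by simp) x).lineDeriv_eq_fderiv, map_neg]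
  ring

theorem memW12_of_lipschitzWith (hU : MeasurableSet U) (hUb : Bornology.IsBounded U)
    (hu : LipschitzWith C u) : MemW12 U u := by
  have : IsFiniteMeasure (volume.restrict U) := isFiniteMeasure_restrict.2 hUb.measure_lt_top.ne
  obtain ⟨B, hB⟩ := (hu.isBounded_image hUb).exists_norm_le
  exact ⟨.of_bound hu.continuous.aestronglyMeasurable B
      (ae_restrict_of_forall_mem hU fun x hx => hB _ ⟨x, hx, rfl⟩),
    fun i => ⟨_, isWeakPartial_lineDeriv hu i,
      .of_bound (aestronglyMeasurable_lineDeriv hu.continuous _) C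
        (.of_forall (abs_lineDeriv_single_le hu i))⟩⟩

variable {ι : Type*} [Fintype ι] {f : Plane → ι → ℝ}

theorem sum_sq_lineDeriv_le (hf : ∀ a, LipschitzWith C fun x => f x a) (x : Plane) :
    ∑ a, ∑ i : Fin 2, lineDeriv ℝ (fun y => f y a) x (EuclideanSpace.single i 1) ^ 2 ≤
      Fintype.card ι * (2 * C ^ 2) :=
  calc ∑ a, ∑ i : Fin 2, lineDeriv ℝ (fun y => f y a) x (EuclideanSpace.single i 1) ^ 2
      ≤ ∑ _a : ι, ∑ _i : Fin 2, (C : ℝ) ^ 2 := by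
        gcongr ∑ a, ∑ i, ?_ with a _ i
        exact sq_le_sq.2 ((abs_lineDeriv_single_le (hf a) i x).trans (le_abs_self _))
    _ = Fintype.card ι * (2 * C ^ 2) := by simp

theorem dirichlet_le_of_lipschitzWith (hU : IsOpen U) (hS : MeasurableSet S)
    (hUS : volume (U ∩ S) ≠ ⊤) (hf : ∀ a, LipschitzWith C fun x => f x a)
    (hconst : ∀ x ∈ U, x ∉ S → ∀ᶠ y in 𝓝 x, f y = f x) :
    dirichlet U f ≤ Fintype.card ι * (2 * C ^ 2) * volume.real (U ∩ S) := by
  have hpartial : ∀ᵐ x ∂volume.restrict U, ∀ a i, weakPartial U i (fun y => f y a) x =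
      lineDeriv ℝ (fun y => f y a) x (EuclideanSpace.single i 1) :=
    ae_all_iff.2 fun a => ae_all_iff.2 fun i =>
      (isWeakPartial_lineDeriv (hf a) i).weakPartial_ae_eq hU
  have hbound : ∀ᵐ x ∂volume.restrict U, ∑ a, ∑ i, weakPartial U i (fun y => f y a) x ^ 2 ≤
      S.indicator (fun _ => (Fintype.card ι * (2 * C ^ 2) : ℝ)) x := by
    filter_upwards [hpartial, ae_restrict_mem hU.measurableSet] with x hx hxU
    simp only [hx]
    by_cases hxS : x ∈ S
    · simpa only [hxS, Set.indicator_of_mem] using sum_sq_lineDeriv_le hf x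
    · have hzero (a : ι) (i : Fin 2) :
          lineDeriv ℝ (fun y => f y a) x (EuclideanSpace.single i 1) = 0 := by
        rw [EventuallyEq.lineDeriv_eq (f := fun _ => f x a)
          ((hconst x hxU hxS).mono fun y hy => congrFun hy a), lineDeriv]
        exact deriv_const _ _
      simp [hzero, hxS]
  calc dirichlet U f
      ≤ ∫ x in U, S.indicator (fun _ => (Fintype.card ι * (2 * C ^ 2) : ℝ)) x := by
        refine integral_mono_of_nonneg (.of_forall fun x => by positivity) ?_ hbound
        refine (integrable_indicator_iff hS).2 (integrableOn_const ?_)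
        rwa [Measure.restrict_apply hS, Set.inter_comm]
    _ = Fintype.card ι * (2 * C ^ 2) * volume.real (U ∩ S) := by
        rw [integral_indicator_const _ hS, measureReal_restrict_apply hS, Set.inter_comm,
          smul_eq_mul, mul_comm]

end Lipschitz

/-! ### Truncated normalization -/

section TruncNormalize

open scoped NNReal

variable {E : Type*} [NormedAddCommGroup E] [NormedSpace ℝ E] {c : ℝ} {v : E}

/-- The normalization `v / ‖v‖`, made Lipschitz by replacing `‖v‖` with `c` where `‖v‖ ≤ c`. -/
noncomputable def truncNormalize (c : ℝ) (v : E) : E := (max c ‖v‖)⁻¹ • v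

theorem norm_truncNormalize (hc : 0 < c) (v : E) :
    ‖truncNormalize c v‖ = ‖v‖ / max c ‖v‖ := by
  rw [truncNormalize, norm_smul, norm_inv, Real.norm_of_nonneg (hc.le.trans (le_max_left _ _)),
    inv_mul_eq_div]

theorem norm_truncNormalize_le_one (hc : 0 < c) (v : E) : ‖truncNormalize c v‖ ≤ 1 := by
  rw [norm_truncNormalize hc]
  exact div_le_one_of_le₀ (le_max_right _ _) (hc.le.trans (le_max_left _ _))

theorem norm_truncNormalize_eq_one (hc : 0 < c) (hv : c ≤ ‖v‖) : ‖truncNormalize c v‖ = 1 := by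
  rw [norm_truncNormalize hc, max_eq_right hv, div_self (hc.trans_le hv).ne']

theorem truncNormalize_of_norm_eq_one (hc : c ≤ 1) (hv : ‖v‖ = 1) : truncNormalize c v = v := by
  rw [truncNormalize, hv, max_eq_right hc, inv_one, one_smul]

theorem lipschitzWith_truncNormalize {c : ℝ≥0} (hc : 0 < c) :
    LipschitzWith (2 / c) (truncNormalize (E := E) c) := by
  refine LipschitzWith.of_dist_le_mul fun v w => ?_
  have hc' : (0 : ℝ) < c := hc
  set M : ℝ := max c ‖v‖
  set N : ℝ := max c ‖w‖
  have hMpos : 0 < M := hc'.trans_le (le_max_left _ _)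
  have hNpos : 0 < N := hc'.trans_le (le_max_left _ _)
  have hNM : |N - M| ≤ ‖v - w‖ :=
    (abs_max_sub_max_le_max _ _ _ _).trans <| by
      rw [sub_self, abs_zero, norm_sub_rev]
      exact max_le (norm_nonneg _) (abs_norm_sub_norm_le w v)
  have hw : ‖N⁻¹ • w‖ ≤ 1 := norm_truncNormalize_le_one hc' w
  calc dist (M⁻¹ • v) (N⁻¹ • w) = ‖M⁻¹ • ((v - w) + (N - M) • N⁻¹ • w)‖ := by
        rw [dist_eq_norm, smul_smul, sub_mul, mul_inv_cancel₀ hNpos.ne', sub_smul, one_smul,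
          sub_add_sub_cancel, smul_sub, smul_smul, inv_mul_cancel_left₀ hMpos.ne']
    _ ≤ M⁻¹ * (‖v - w‖ + |N - M| * ‖N⁻¹ • w‖) := by
        rw [norm_smul, norm_inv, Real.norm_of_nonneg hMpos.le]
        gcongr
        exact (norm_add_le _ _).trans_eq (by rw [norm_smul (N - M), Real.norm_eq_abs])
    _ ≤ (c : ℝ)⁻¹ * (‖v - w‖ + ‖v - w‖ * 1) := by
        gcongr
        exact le_max_left _ _
    _ = (2 / c : ℝ≥0) * dist v w := by rw [dist_eq_norm]; push_cast; ring

end TruncNormalize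

/-! ### Geometry of the stadium -/

section Geometry

variable {δ : ℝ} {x : Plane}

theorem dist_sq_vertical (x : Plane) (t : ℝ) : dist x !₂[0, t] ^ 2 = x 0 ^ 2 + (x 1 - t) ^ 2 := by
  simp [EuclideanSpace.dist_eq, Real.dist_eq, Real.sq_sqrt, add_nonneg, sq_nonneg]

theorem norm_sq_clockwiseTangent (δ : ℝ) (x : Plane) :
    ‖clockwiseTangent δ x‖ ^ 2 = (x 1 - max (-δ) (min δ (x 1))) ^ 2 + x 0 ^ 2 := by
  simp [clockwiseTangent, EuclideanSpace.norm_sq_eq, Fin.sum_univ_two]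

theorem abs_sub_clamp_sub_sub_clamp_le (δ a b : ℝ) :
    |(a - max (-δ) (min δ a)) - (b - max (-δ) (min δ b))| ≤ |a - b| := by
  grind

theorem lipschitzWith_clockwiseTangent (δ : ℝ) : LipschitzWith 1 (clockwiseTangent δ) := by
  refine LipschitzWith.of_dist_le_mul fun x y => ?_
  rw [NNReal.coe_one, one_mul, EuclideanSpace.dist_eq, EuclideanSpace.dist_eq,
    Fin.sum_univ_two, Fin.sum_univ_two, add_comm (dist (x 0) (y 0) ^ 2)]
  gcongr
  · exact abs_sub_clamp_sub_sub_clamp_le δ (x 1) (y 1)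
  · exact (dist_neg_neg (x 0) (y 0)).le

theorem clockwiseTangent_apply_zero_of_abs_le (hx : |x 1| ≤ δ) : clockwiseTangent δ x 0 = 0 := by
  obtain ⟨hl, hu⟩ := abs_le.1 hx
  simp [clockwiseTangent, hl, hu]

theorem norm_sq_clockwiseTangent_of_le (hδ : 0 ≤ δ) (hx : δ ≤ x 1) :
    ‖clockwiseTangent δ x‖ ^ 2 = x 0 ^ 2 + (x 1 - δ) ^ 2 := by
  rw [norm_sq_clockwiseTangent, min_eq_left hx, max_eq_right (by linarith), add_comm]

theorem norm_sq_clockwiseTangent_of_le_neg (hδ : 0 ≤ δ) (hx : x 1 ≤ -δ) :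
    ‖clockwiseTangent δ x‖ ^ 2 = x 0 ^ 2 + (x 1 + δ) ^ 2 := by
  rw [norm_sq_clockwiseTangent, min_eq_right (by linarith), max_eq_left hx, add_comm,
    sub_neg_eq_add]

theorem norm_sq_clockwiseTangent_of_abs_le (hx : |x 1| ≤ δ) :
    ‖clockwiseTangent δ x‖ ^ 2 = x 0 ^ 2 := by
  obtain ⟨hl, hu⟩ := abs_le.1 hx
  simp [norm_sq_clockwiseTangent, hl, hu]

theorem norm_sq_clockwiseTangent_le (hδ : 0 ≤ δ) {t : ℝ} (ht : |t| ≤ δ) (x : Plane) :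
    ‖clockwiseTangent δ x‖ ^ 2 ≤ x 0 ^ 2 + (x 1 - t) ^ 2 := by
  obtain ⟨hl, hu⟩ := abs_le.1 ht
  rcases le_total δ (x 1) with h | h
  · rw [norm_sq_clockwiseTangent_of_le hδ h]
    nlinarith
  rcases le_total (x 1) (-δ) with h' | h'
  · rw [norm_sq_clockwiseTangent_of_le_neg hδ h']
    nlinarith
  · rw [norm_sq_clockwiseTangent_of_abs_le (abs_le.2 ⟨h', h⟩)]
    nlinarith

theorem fullStadium_eq (hδ : 0 ≤ δ) : fullStadium δ = {x | ‖clockwiseTangent δ x‖ < 1} := by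
  ext x
  rw [Set.mem_ofPred_eq, ← sq_lt_one_iff₀ (norm_nonneg _)]
  refine ⟨?_, fun hx => ?_⟩
  · rintro ((h | h) | ⟨h₀, h₁⟩)
    · exact (norm_sq_clockwiseTangent_le hδ (abs_of_nonneg hδ).le x).trans_lt h
    · refine (norm_sq_clockwiseTangent_le (t := -δ) hδ ?_ x).trans_lt (by rwa [sub_neg_eq_add])
      rw [abs_neg, abs_of_nonneg hδ]
    · rwa [norm_sq_clockwiseTangent_of_abs_le h₁, sq_lt_one_iff_abs_lt_one]
  · by_cases h : |x 1| ≤ δ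
    · rw [norm_sq_clockwiseTangent_of_abs_le h, sq_lt_one_iff_abs_lt_one] at hx
      exact .inr ⟨hx, h⟩
    rcases lt_abs.1 (not_le.1 h) with h | h
    · rw [norm_sq_clockwiseTangent_of_le hδ h.le] at hx
      exact .inl (.inl hx)
    · rw [norm_sq_clockwiseTangent_of_le_neg hδ (by linarith)] at hx
      exact .inl (.inr hx)

theorem isOpen_stadium (hδ : 0 ≤ δ) : IsOpen (stadium δ) := by
  rw [stadium, fullStadium_eq hδ]
  refine (isOpen_lt (lipschitzWith_clockwiseTangent δ).continuous.norm continuous_const).sdiff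
    (.union ?_ ?_) <;>
  exact isClosed_le (by fun_prop) continuous_const

theorem norm_clockwiseTangent_lt_one (hδ : 0 ≤ δ) (hx : x ∈ stadium δ) :
    ‖clockwiseTangent δ x‖ < 1 :=
  (fullStadium_eq hδ).subset hx.1

theorem norm_clockwiseTangent_of_mem_outerBoundary (hδ : 0 ≤ δ) (hx : x ∈ outerBoundary δ) :
    ‖clockwiseTangent δ x‖ = 1 := by
  rw [outerBoundary, fullStadium_eq hδ] at hx
  exact frontier_lt_subset_eq (lipschitzWith_clockwiseTangent δ).continuous.norm
    continuous_const hx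

theorem half_lt_norm_sq_clockwiseTangent (hδ : 0 ≤ δ) (hx : x ∈ stadium δ)
    (h₀ : clockwiseTangent δ x 0 ≠ 0) : 1 / 2 < ‖clockwiseTangent δ x‖ ^ 2 := by
  have hcap : δ < |x 1| := not_le.1 fun h => h₀ (clockwiseTangent_apply_zero_of_abs_le h)
  rcases lt_abs.1 hcap with h | h
  · rw [norm_sq_clockwiseTangent_of_le hδ h.le]
    exact not_le.1 fun h' => hx.2 (.inl h')
  · rw [norm_sq_clockwiseTangent_of_le_neg hδ (by linarith)]
    exact not_le.1 fun h' => hx.2 (.inr h')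

theorem isBounded_stadium (hδ : 0 ≤ δ) : Bornology.IsBounded (stadium δ) := by
  refine isBounded_iff_forall_norm_le.2 ⟨1 + δ, fun x hx => ?_⟩
  set t := max (-δ) (min δ (x 1))
  have hdist : dist x !₂[0, t] = ‖clockwiseTangent δ x‖ := by
    rw [← sq_eq_sq₀ dist_nonneg (norm_nonneg _), dist_sq_vertical, norm_sq_clockwiseTangent,
      add_comm]
  have hnorm : ‖(!₂[0, t] : Plane)‖ = |t| := by
    simp [EuclideanSpace.norm_eq, Real.sqrt_sq_eq_abs]
  have habs : |t| ≤ δ := abs_le.2 ⟨le_max_left _ _, max_le (by linarith) (min_le_left _ _)⟩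
  calc ‖x‖ ≤ ‖(!₂[0, t] : Plane)‖ + ‖x - !₂[0, t]‖ := norm_le_insert' _ _
    _ ≤ 1 + δ := by
      rw [← dist_eq_norm, hdist, hnorm, add_comm]
      exact add_le_add (norm_clockwiseTangent_lt_one hδ hx).le habs

theorem stadium_inter_caps_subset (hδ : 0 ≤ δ) : stadium δ ∩ {x | δ ≤ |x 1|} ⊆
    Metric.closedBall !₂[0, δ] 1 ∪ Metric.closedBall !₂[0, -δ] 1 := by
  rintro x ⟨hx, hcap : δ ≤ |x 1|⟩
  have hnorm := (norm_clockwiseTangent_lt_one hδ hx).le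
  rw [← sq_le_one_iff₀ (norm_nonneg _)] at hnorm
  simp only [Set.mem_union, Metric.mem_closedBall, ← sq_le_one_iff₀ dist_nonneg,
    dist_sq_vertical, sub_neg_eq_add]
  rcases le_abs.1 hcap with h | h
  · exact .inl (norm_sq_clockwiseTangent_of_le hδ h ▸ hnorm)
  · exact .inr (norm_sq_clockwiseTangent_of_le_neg hδ (le_neg_of_le_neg h) ▸ hnorm)

theorem volume_stadium_inter_caps_le (hδ : 0 ≤ δ) :
    volume.real (stadium δ ∩ {x | δ ≤ |x 1|}) ≤
      2 * volume.real (Metric.closedBall (0 : Plane) 1) := by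
  refine (measureReal_mono (stadium_inter_caps_subset hδ) ?_).trans ?_
  · exact (measure_union_lt_top measure_closedBall_lt_top measure_closedBall_lt_top).ne
  refine (measureReal_union_le _ _).trans_eq ?_
  rw [two_mul]
  congr 1 <;> rw [Measure.real, Measure.addHaar_closedBall_center, Measure.real]

end Geometry

/-! ### The competing line field -/

section LineFields

open scoped NNReal

variable {s δ : ℝ}

/-- The line tensor of `v`, with the missing part `1 - ‖v‖²` of the unit length filled in along
the `x₂`-axis, so that on the axis `v 0 = 0` it does not depend on `v`. -/
noncomputable def filledLineTensor (s : ℝ) (v : Plane) : Matrix (Fin 3) (Fin 3) ℝ :=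
  lineTensor s v + (s * (1 - ‖v‖ ^ 2)) • Matrix.vecMulVec ![0, 1, 0] ![0, 1, 0]

theorem filledLineTensor_of_norm_eq_one {v : Plane} (hv : ‖v‖ = 1) :
    filledLineTensor s v = lineTensor s v := by
  simp [filledLineTensor, hv]

theorem filledLineTensor_of_apply_zero_eq_zero {v : Plane} (hv : v 0 = 0) :
    filledLineTensor s v = lineTensor s (EuclideanSpace.single 1 1) := by
  ext a b
  fin_cases a <;> fin_cases b <;>
    simp [filledLineTensor, lineTensor, EuclideanSpace.norm_sq_eq, Fin.sum_univ_two, hv]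
  ring

theorem filledLineTensor_apply (s : ℝ) (v : Plane) (a b : Fin 3) :
    filledLineTensor s v a b =
      s * ((![v 0, v 1, 0] : Fin 3 → ℝ) a * (![v 0, v 1, 0] : Fin 3 → ℝ) b -
        (‖v‖ * (![0, 1, 0] : Fin 3 → ℝ) a) * (‖v‖ * (![0, 1, 0] : Fin 3 → ℝ) b) +
        ((![0, 1, 0] : Fin 3 → ℝ) a * (![0, 1, 0] : Fin 3 → ℝ) b -
          1 / 3 * (1 : Matrix (Fin 3) (Fin 3) ℝ) a b)) := by
  simp only [filledLineTensor, lineTensor, Matrix.add_apply, Matrix.smul_apply, Matrix.sub_apply,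
    Matrix.vecMulVec_apply, smul_eq_mul]
  ring

theorem lipschitzWith_filledLineTensor_comp (s : ℝ) {α : Type*} [PseudoMetricSpace α]
    {f : α → Plane} {K : ℝ≥0} (hf : LipschitzWith K f) (hf1 : ∀ x, ‖f x‖ ≤ 1) (a b : Fin 3) :
    LipschitzWith (‖s‖₊ * (K + K + (K + K))) fun x => filledLineTensor s (f x) a b := by
  have hm (c : Fin 3) : LipschitzWith K (fun x => (![f x 0, f x 1, 0] : Fin 3 → ℝ) c) ∧
      ∀ x, ‖(![f x 0, f x 1, 0] : Fin 3 → ℝ) c‖ ≤ 1 := by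
    have happly (i : Fin 2) : LipschitzWith K (fun x => f x i) ∧ ∀ x, ‖f x i‖ ≤ 1 :=
      ⟨one_mul K ▸ (lipschitzWith_apply i).comp hf,
        fun x => (PiLp.norm_apply_le (f x) i).trans (hf1 x)⟩
    fin_cases c
    · exact happly 0
    · exact happly 1
    · exact ⟨(LipschitzWith.const 0).weaken bot_le, fun x => by simp⟩
  have he (c : Fin 3) : LipschitzWith K (fun x => ‖f x‖ * (![0, 1, 0] : Fin 3 → ℝ) c) ∧
      ∀ x, ‖‖f x‖ * (![0, 1, 0] : Fin 3 → ℝ) c‖ ≤ 1 := by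
    have hnorm : LipschitzWith K fun x => ‖f x‖ := one_mul K ▸ lipschitzWith_one_norm.comp hf
    fin_cases c <;> simp [hf1, hnorm, (LipschitzWith.const (0 : ℝ)).weaken (bot_le (a := K))]
  have hdiff := (lipschitzWith_mul_of_norm_le_one (hm a).1 (hm b).1 (hm a).2 (hm b).2).sub
    (lipschitzWith_mul_of_norm_le_one (he a).1 (he b).1 (he a).2 (he b).2)
  simp only [filledLineTensor_apply]
  exact (lipschitzWith_smul s).comp (add_zero (K + K + (K + K)) ▸ hdiff.add (.const _))

/-- The tangent line field, extended from the outer boundary to the stadium: it is constant along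
the straight part of the stadium, whose two sides carry the same tangent line. -/
noncomputable def tangentLineField (s δ : ℝ) (x : Plane) : Matrix (Fin 3) (Fin 3) ℝ :=
  filledLineTensor s (truncNormalize (1 / 2 : ℝ≥0) (clockwiseTangent δ x))

theorem lipschitzWith_tangentLineField (s δ : ℝ) (a b : Fin 3) :
    LipschitzWith (‖s‖₊ * 16) fun x => tangentLineField s δ x a b := by
  have hK : (16 : ℝ≥0) =
      2 / (1 / 2) * 1 + 2 / (1 / 2) * 1 + (2 / (1 / 2) * 1 + 2 / (1 / 2) * 1) := by norm_num
  exact hK ▸ lipschitzWith_filledLineTensor_comp s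
    ((lipschitzWith_truncNormalize (by norm_num)).comp (lipschitzWith_clockwiseTangent δ))
    (fun x => norm_truncNormalize_le_one (by norm_num) _) a b

theorem tangentLineField_eq_of_abs_le {x : Plane} (hx : |x 1| ≤ δ) :
    tangentLineField s δ x = lineTensor s (EuclideanSpace.single 1 1) :=
  filledLineTensor_of_apply_zero_eq_zero <| by
    simp [truncNormalize, clockwiseTangent_apply_zero_of_abs_le hx]

theorem eventually_tangentLineField_eq_of_abs_lt {x : Plane} (hx : |x 1| < δ) :
    ∀ᶠ y in 𝓝 x, tangentLineField s δ y = tangentLineField s δ x := by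
  have hnear : ∀ᶠ y : Plane in 𝓝 x, |y 1| < δ :=
    (isOpen_lt (by fun_prop) continuous_const).mem_nhds hx
  filter_upwards [hnear] with y hy
  rw [tangentLineField_eq_of_abs_le hy.le, tangentLineField_eq_of_abs_le hx.le]

theorem tangentLineField_mem_Q₂ (hδ : 0 ≤ δ) {x : Plane} (hx : x ∈ stadium δ) :
    tangentLineField s δ x ∈ Q₂ s := by
  by_cases h₀ : clockwiseTangent δ x 0 = 0
  · exact ⟨EuclideanSpace.single 1 1, by simp, filledLineTensor_of_apply_zero_eq_zero <| by
      simp [truncNormalize, h₀]⟩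
  · have hhalf : 1 / 2 ≤ ‖clockwiseTangent δ x‖ := by
      nlinarith [half_lt_norm_sq_clockwiseTangent hδ hx h₀, norm_nonneg (clockwiseTangent δ x)]
    have hunit : ‖truncNormalize (1 / 2 : ℝ≥0) (clockwiseTangent δ x)‖ = 1 :=
      norm_truncNormalize_eq_one (by norm_num) (by simpa using hhalf)
    exact ⟨_, hunit, filledLineTensor_of_norm_eq_one hunit⟩

theorem tangentLineField_of_mem_outerBoundary (hδ : 0 ≤ δ) {x : Plane}
    (hx : x ∈ outerBoundary δ) :
    tangentLineField s δ x = lineTensor s (clockwiseTangent δ x) := by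
  have hunit := norm_clockwiseTangent_of_mem_outerBoundary hδ hx
  rw [tangentLineField, truncNormalize_of_norm_eq_one (by push_cast; norm_num) hunit,
    filledLineTensor_of_norm_eq_one hunit]

theorem tangentLineField_mem_tangentLineFields (s : ℝ) (hδ : 0 ≤ δ) :
    tangentLineField s δ ∈ tangentLineFields s δ := by
  have hmem (a b : Fin 3) : MemW12 (stadium δ) fun x => tangentLineField s δ x a b :=
    memW12_of_lipschitzWith (isOpen_stadium hδ).measurableSet (isBounded_stadium hδ)
      (lipschitzWith_tangentLineField s δ a b)
  exact ⟨hmem, ae_restrict_of_forall_mem (isOpen_stadium hδ).measurableSet fun x hx =>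
      tangentLineField_mem_Q₂ hδ hx,
    fun a b => (hmem a b).hasTrace_of_continuousOn (isOpen_stadium hδ)
      isClosed_frontier.measurableSet
      (lipschitzWith_tangentLineField s δ a b).continuous.continuousOn fun x hx => by
        beta_reduce
        rw [tangentLineField_of_mem_outerBoundary hδ hx]⟩

theorem lineEnergy_tangentLineField_le (s : ℝ) (hδ : 0 ≤ δ) :
    lineEnergy δ (tangentLineField s δ) ≤
      9216 * volume.real (Metric.closedBall (0 : Plane) 1) * s ^ 2 := by
  have hcaps : MeasurableSet {x : Plane | δ ≤ |x 1|} :=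
    (isClosed_le continuous_const (by fun_prop)).measurableSet
  have hfin : volume (stadium δ ∩ {x | δ ≤ |x 1|}) ≠ ⊤ :=
    ((isBounded_stadium hδ).subset Set.inter_subset_left).measure_lt_top.ne
  calc lineEnergy δ (tangentLineField s δ)
      ≤ Fintype.card (Fin 3 × Fin 3) * (2 * (‖s‖₊ * 16 : ℝ≥0) ^ 2) *
          volume.real (stadium δ ∩ {x | δ ≤ |x 1|}) :=
        dirichlet_le_of_lipschitzWith (isOpen_stadium hδ) hcaps hfin
          (fun p => lipschitzWith_tangentLineField s δ p.1 p.2) fun x _ hx =>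
            (eventually_tangentLineField_eq_of_abs_lt (not_le.1 hx)).mono fun y hy => by rw [hy]
    _ ≤ Fintype.card (Fin 3 × Fin 3) * (2 * (‖s‖₊ * 16 : ℝ≥0) ^ 2) *
          (2 * volume.real (Metric.closedBall (0 : Plane) 1)) := by
        gcongr
        exact volume_stadium_inter_caps_le hδ
    _ = 9216 * volume.real (Metric.closedBall (0 : Plane) 1) * s ^ 2 := by
        simp only [Fintype.card_prod, Fintype.card_fin, NNReal.coe_mul, coe_nnnorm,
          Real.norm_eq_abs, mul_pow, sq_abs]
        push_cast
        ring

end LineFields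

/-! ### A competing vector field -/

section VectorFields

open scoped NNReal

variable {δ σ : ℝ}

/-- The clockwise tangent, which vanishes on the axis of the stadium, deformed to a field without
zeros: the missing part `1 - ‖clockwiseTangent δ x‖` of the unit length is added along the
`x₁`-axis. -/
noncomputable def filledTangent (δ : ℝ) (x : Plane) : Plane :=
  clockwiseTangent δ x + (1 - ‖clockwiseTangent δ x‖) • EuclideanSpace.single 0 1

theorem lipschitzWith_filledTangent (δ : ℝ) : LipschitzWith 2 (filledTangent δ) := by
  have hnorm : LipschitzWith (0 + 1) fun x => 1 - ‖clockwiseTangent δ x‖ :=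
    (LipschitzWith.const 1).sub (one_mul (1 : ℝ≥0) ▸
      lipschitzWith_one_norm.comp (lipschitzWith_clockwiseTangent δ))
  have hsmul : LipschitzWith 1 fun x =>
      (1 - ‖clockwiseTangent δ x‖) • (EuclideanSpace.single 0 1 : Plane) :=
    .of_dist_le_mul fun x y => by
      have := hnorm.dist_le_mul x y
      rw [zero_add] at this
      rwa [dist_eq_norm, ← sub_smul, norm_smul, PiLp.norm_single, norm_one, mul_one,
        ← dist_eq_norm]
  exact one_add_one_eq_two (R := ℝ≥0) ▸ (lipschitzWith_clockwiseTangent δ).add hsmul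

theorem quarter_le_norm_filledTangent (hδ : 0 ≤ δ) {x : Plane} (hx : x ∈ stadium δ) :
    1 / 4 ≤ ‖filledTangent δ x‖ := by
  have hlt := norm_clockwiseTangent_lt_one hδ hx
  by_cases h₀ : clockwiseTangent δ x 0 = 0
  · have hfst := PiLp.norm_apply_le (filledTangent δ x) 0
    have hsnd := PiLp.norm_apply_le (filledTangent δ x) 1
    have hnorm : ‖clockwiseTangent δ x‖ = |clockwiseTangent δ x 1| := by
      simp [EuclideanSpace.norm_eq, Fin.sum_univ_two, h₀, Real.sqrt_sq_eq_abs]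
    simp only [filledTangent, PiLp.add_apply, PiLp.smul_apply, h₀, hnorm, Real.norm_eq_abs,
      PiLp.single_apply, Fin.isValue, if_true, one_ne_zero, if_false, smul_eq_mul,
      mul_one, mul_zero, zero_add, add_zero] at hfst hsnd ⊢
    linarith [le_abs_self (1 - |clockwiseTangent δ x 1|)]
  · have hhalf := half_lt_norm_sq_clockwiseTangent hδ hx h₀
    have hfill : ‖(1 - ‖clockwiseTangent δ x‖) • (EuclideanSpace.single 0 1 : Plane)‖ =
        1 - ‖clockwiseTangent δ x‖ := by
      rw [norm_smul, PiLp.norm_single, norm_one, mul_one,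
        Real.norm_of_nonneg (sub_nonneg.2 hlt.le)]
    have htri := norm_sub_le_norm_add (clockwiseTangent δ x)
      ((1 - ‖clockwiseTangent δ x‖) • (EuclideanSpace.single 0 1 : Plane))
    rw [hfill] at htri
    rw [filledTangent]
    have hlarge : 5 / 8 < ‖clockwiseTangent δ x‖ :=
      lt_of_pow_lt_pow_left₀ 2 (norm_nonneg _) (by norm_num; linarith)
    linarith

/-- A tangent vector field with the orientation `σ`. -/
noncomputable def tangentVectorField (δ σ : ℝ) (x : Plane) : Plane :=
  σ • truncNormalize (1 / 4 : ℝ≥0) (filledTangent δ x)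

theorem lipschitzWith_tangentVectorField (δ σ : ℝ) :
    LipschitzWith (‖σ‖₊ * (2 / (1 / 4) * 2)) (tangentVectorField δ σ) :=
  (lipschitzWith_smul σ).comp ((lipschitzWith_truncNormalize (by norm_num)).comp
    (lipschitzWith_filledTangent δ))

theorem norm_tangentVectorField (hδ : 0 ≤ δ) {x : Plane} (hx : x ∈ stadium δ) :
    ‖tangentVectorField δ σ x‖ = |σ| := by
  rw [tangentVectorField, norm_smul, norm_truncNormalize_eq_one (by norm_num)
    (by push_cast; exact quarter_le_norm_filledTangent hδ hx), mul_one, Real.norm_eq_abs]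

theorem tangentVectorField_of_mem_outerBoundary (hδ : 0 ≤ δ) {x : Plane}
    (hx : x ∈ outerBoundary δ) :
    tangentVectorField δ σ x = σ • clockwiseTangent δ x := by
  have hunit := norm_clockwiseTangent_of_mem_outerBoundary hδ hx
  rw [tangentVectorField, filledTangent, hunit, sub_self, zero_smul, add_zero,
    truncNormalize_of_norm_eq_one (by push_cast; norm_num) hunit]

theorem tangentVectorField_mem_tangentVectorFields (hδ : 0 ≤ δ) (hσ : |σ| = 1) :
    tangentVectorField δ σ ∈ tangentVectorFields δ σ := by
  have hlip (a : Fin 2) := (lipschitzWith_apply a).comp (lipschitzWith_tangentVectorField δ σ)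
  have hmem (a : Fin 2) : MemW12 (stadium δ) fun x => tangentVectorField δ σ x a :=
    memW12_of_lipschitzWith (isOpen_stadium hδ).measurableSet (isBounded_stadium hδ) (hlip a)
  exact ⟨hmem, ae_restrict_of_forall_mem (isOpen_stadium hδ).measurableSet fun x hx =>
      (norm_tangentVectorField hδ hx).trans hσ,
    fun a => (hmem a).hasTrace_of_continuousOn (isOpen_stadium hδ)
      isClosed_frontier.measurableSet (hlip a).continuous.continuousOn fun x hx => by
        beta_reduce
        rw [tangentVectorField_of_mem_outerBoundary hδ hx, PiLp.smul_apply, smul_eq_mul]⟩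

end VectorFields

/-! ### Weak derivatives on an interval -/

section Interval

variable {a b : ℝ} {φ f G H : ℝ → ℝ}

namespace IsTestFunction

theorem deriv (hφ : IsTestFunction (Set.Ioo a b) φ) : IsTestFunction (Set.Ioo a b) (deriv φ) :=
  hφ.fderiv_apply 1

theorem intervalIntegral_mul (hφ : IsTestFunction (Set.Ioo a b) φ) (hab : a ≤ b) (g : ℝ → ℝ) :
    ∫ x in a..b, g x * φ x = ∫ x, g x * φ x := by
  rw [intervalIntegral.integral_of_le hab, integral_Ioc_eq_integral_Ioo, hφ.setIntegral_mul]

end IsTestFunction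

theorem exists_Icc_of_isCompact_subset_Ioo (hab : a < b) {K : Set ℝ} (hK : IsCompact K)
    (hKab : K ⊆ Set.Ioo a b) : ∃ c d, a < c ∧ d < b ∧ K ⊆ Set.Icc c d := by
  obtain ⟨m, hm⟩ := exists_between hab
  have hK' : IsCompact (insert m K) := hK.insert m
  have hne : (insert m K).Nonempty := Set.insert_nonempty m K
  have hsub : insert m K ⊆ Set.Ioo a b := Set.insert_subset hm hKab
  exact ⟨_, _, (hsub (hK'.sInf_mem hne)).1, (hsub (hK'.sSup_mem hne)).2,
    (Set.subset_insert m K).trans hK'.isBounded.subset_Icc_sInf_sSup⟩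

theorem exists_isTestFunction_deriv_eq (hab : a < b) (hφ : IsTestFunction (Set.Ioo a b) φ)
    (hmean : ∫ x, φ x = 0) : ∃ χ, IsTestFunction (Set.Ioo a b) χ ∧ deriv χ = φ := by
  obtain ⟨c, d, hac, hdb, hcd⟩ :=
    exists_Icc_of_isCompact_subset_Ioo hab hφ.hasCompactSupport hφ.tsupport_subset
  have hzero {x : ℝ} (hx : x ∉ Set.Icc c d) : φ x = 0 :=
    image_eq_zero_of_notMem_tsupport fun h => hx (hcd h)
  have hcont : Continuous φ := hφ.contDiff.continuous
  have hderiv (x : ℝ) : HasDerivAt (fun x => ∫ t in a..x, φ t) (φ x) x :=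
    hcont.integral_hasStrictDerivAt a x |>.hasDerivAt
  have hoff (x : ℝ) (hx : x ∉ Set.Icc c d) : ∫ t in a..x, φ t = 0 := by
    rcases lt_or_ge x c with hxc | hcx
    · refine intervalIntegral.integral_zero_ae (.of_forall fun t ht => hzero fun htc => ?_)
      exact absurd (ht.2.trans_lt (max_lt hac hxc)) htc.1.not_gt
    · rw [intervalIntegral.integral_eq_integral_of_support_subset, hmean]
      intro t ht
      have htcd : t ∈ Set.Icc c d := hcd (subset_tsupport φ ht)
      exact ⟨hac.trans_le htcd.1, htcd.2.trans (not_le.1 fun h => hx ⟨hcx, h⟩).le⟩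
  refine ⟨fun x => ∫ t in a..x, φ t, ⟨?_, .intro isCompact_Icc hoff, ?_⟩,
    funext fun x => (hderiv x).deriv⟩
  · rw [contDiff_infty_iff_deriv]
    exact ⟨fun x => (hderiv x).differentiableAt, by
      rw [funext fun x => (hderiv x).deriv]; exact hφ.contDiff⟩
  · refine (closure_minimal (fun x hx => ?_) isClosed_Icc).trans (Set.Icc_subset_Ioo hac hdb)
    exact by_contra fun h => hx (hoff x h)

theorem exists_isTestFunction_integral_eq_one (hab : a < b) :
    ∃ η, IsTestFunction (Set.Ioo a b) η ∧ ∫ x, η x = 1 := by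
  let bump : ContDiffBump ((a + b) / 2) := ⟨(b - a) / 8, (b - a) / 4, by linarith, by linarith⟩
  refine ⟨bump.normed volume, ⟨bump.contDiff_normed, bump.hasCompactSupport_normed, ?_⟩,
    bump.integral_normed⟩
  rw [bump.tsupport_normed_eq, Real.closedBall_eq_Icc]
  exact Set.Icc_subset_Ioo (by simp only [bump]; linarith) (by simp only [bump]; linarith)

theorem exists_eqOn_const_of_integral_mul_deriv_eq_zero (hab : a < b)
    (hf : ContinuousOn f (Set.Icc a b))
    (h : ∀ χ, IsTestFunction (Set.Ioo a b) χ → ∫ x, f x * deriv χ x = 0) :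
    ∃ C, Set.EqOn f (fun _ => C) (Set.Icc a b) := by
  obtain ⟨η, hη, hη1⟩ := exists_isTestFunction_integral_eq_one hab
  have hloc : LocallyIntegrableOn f (Set.Ioo a b) :=
    (hf.mono Set.Ioo_subset_Icc_self).locallyIntegrableOn measurableSet_Ioo
  set C := ∫ x, f x * η x with hC
  have hmean (φ : ℝ → ℝ) (hφ : IsTestFunction (Set.Ioo a b) φ) :
      ∫ x, f x * φ x = C * ∫ x, φ x := by
    obtain ⟨χ, hχ, hχφ⟩ := exists_isTestFunction_deriv_eq hab
        (hφ.sub (hη.const_smul (∫ x, φ x))) <| by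
      simp only [Pi.sub_apply, Pi.smul_apply, smul_eq_mul]
      rw [integral_sub hφ.integrable (hη.integrable.const_mul _), integral_const_mul, hη1,
        mul_one, sub_self]
    have hzero := h χ hχ
    simp only [hχφ, Pi.sub_apply, Pi.smul_apply, smul_eq_mul, mul_sub,
      mul_left_comm (f _) (∫ x, φ x)] at hzero
    rw [integral_sub (hφ.integrable_mul hloc) ((hη.integrable_mul hloc).const_mul _),
      integral_const_mul, ← hC, sub_eq_zero, mul_comm] at hzero
    exact hzero
  have hae : ∀ᵐ x, x ∈ Set.Ioo a b → f x - C = 0 := by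
    refine ae_eq_zero_of_integral_mul_isTestFunction isOpen_Ioo
      (hloc.sub (locallyIntegrableOn_const C)) fun φ hφ => ?_
    simp only [sub_mul]
    rw [integral_sub (hφ.integrable_mul hloc) (hφ.integrable.const_mul C), hmean φ hφ,
      integral_const_mul, sub_self]
  refine ⟨C, Measure.eqOn_Icc_of_ae_eq volume hab.ne ?_ hf continuousOn_const⟩
  rw [Filter.EventuallyEq, ← restrict_Ioo_eq_restrict_Icc, ae_restrict_iff' measurableSet_Ioo]
  exact hae.mono fun x hx hxab => sub_eq_zero.1 (hx hxab)

theorem integral_intervalIntegral_mul_deriv (hab : a ≤ b) (hG : IntervalIntegrable G volume a b)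
    (hφ : IsTestFunction (Set.Ioo a b) φ) :
    ∫ x, (∫ t in a..x, G t) * deriv φ x = -∫ x, G x * φ x := by
  have hprim := hG.absolutelyContinuousOnInterval_intervalIntegral (c := a) Set.left_mem_uIcc
  obtain ⟨K, hK⟩ := ContDiff.lipschitzWith_of_hasCompactSupport hφ.hasCompactSupport
    hφ.contDiff (by simp)
  have hparts := hprim.integral_mul_deriv_eq_deriv_mul
    (hK.lipschitzOnWith.absolutelyContinuousOnInterval (a := a) (b := b))
  have hderiv : ∫ x in a..b, deriv (fun x => ∫ t in a..x, G t) x * φ x =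
      ∫ x in a..b, G x * φ x := by
    refine intervalIntegral.integral_congr_ae ?_
    filter_upwards [hG.ae_hasDerivAt_integral] with x hx hxab
    rw [(hx (Set.uIoc_subset_uIcc hxab) a Set.left_mem_uIcc).deriv]
  rw [← hφ.deriv.intervalIntegral_mul hab, hparts, hderiv, hφ.intervalIntegral_mul hab,
    hφ.eq_zero_of_notMem Set.left_notMem_Ioo, hφ.eq_zero_of_notMem Set.right_notMem_Ioo]
  ring

theorem integral_eq_sub_of_integral_mul_deriv_eq_neg (hab : a < b)
    (hH : ContinuousOn H (Set.Icc a b)) (hG : IntervalIntegrable G volume a b)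
    (h : ∀ χ, IsTestFunction (Set.Ioo a b) χ → ∫ x, H x * deriv χ x = -∫ x, G x * χ x) :
    ∫ x in a..b, G x = H b - H a := by
  have hprim : ContinuousOn (fun x => ∫ t in a..x, G t) (Set.Icc a b) := by
    rw [← Set.uIcc_of_le hab.le]
    exact (hG.absolutelyContinuousOnInterval_intervalIntegral Set.left_mem_uIcc).continuousOn
  obtain ⟨C, hC⟩ := exists_eqOn_const_of_integral_mul_deriv_eq_zero hab (hH.sub hprim)
    fun χ hχ => by
      have hloc {u : ℝ → ℝ} (hu : ContinuousOn u (Set.Icc a b)) :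
          LocallyIntegrableOn u (Set.Ioo a b) :=
        (hu.mono Set.Ioo_subset_Icc_self).locallyIntegrableOn measurableSet_Ioo
      simp only [Pi.sub_apply, sub_mul]
      rw [integral_sub (hχ.deriv.integrable_mul (hloc hH))
        (hχ.deriv.integrable_mul (hloc hprim)), h χ hχ,
        integral_intervalIntegral_mul_deriv hab.le hG hχ, sub_self]
  have ha := hC (Set.left_mem_Icc.2 hab.le)
  have hb := hC (Set.right_mem_Icc.2 hab.le)
  simp only [Pi.sub_apply, intervalIntegral.integral_same] at ha hb
  linarith

end Interval

/-! ### Rectangles -/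

section Rectangle

variable {s t : Set ℝ} {F : Plane → ℝ} {χ ψ : ℝ → ℝ}

/-- The rectangle `s × t` in the plane. -/
def rectangle (s t : Set ℝ) : Set Plane := {x | x 0 ∈ s ∧ x 1 ∈ t}

/-- The identification of `ℝ × ℝ`, where Fubini's theorem lives, with the Euclidean plane. -/
def planeOfProd : ℝ × ℝ ≃ᵐ Plane :=
  MeasurableEquiv.finTwoArrow.symm.trans (MeasurableEquiv.toLp 2 (Fin 2 → ℝ))

theorem continuous_planeOfProd : Continuous planeOfProd := by
  change Continuous fun p : ℝ × ℝ => (!₂[p.1, p.2] : Plane)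
  fun_prop

theorem measurePreserving_planeOfProd : MeasurePreserving planeOfProd :=
  (PiLp.volume_preserving_toLp (Fin 2)).comp (volume_preserving_finTwoArrow ℝ).symm

theorem planeOfProd_preimage_rectangle : planeOfProd ⁻¹' rectangle s t = s ×ˢ t := rfl

theorem planeOfProd_image_prod : planeOfProd '' (s ×ˢ t) = rectangle s t :=
  planeOfProd.surjective.image_preimage (rectangle s t)

theorem volume_real_rectangle :
    volume.real (rectangle s t) = volume.real s * volume.real t := by
  rw [measureReal_def, ← measurePreserving_planeOfProd.measure_preimage_equiv,
    planeOfProd_preimage_rectangle, Measure.volume_eq_prod, ← measureReal_def,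
    measureReal_prod_prod]

theorem integrable_prod_of_integrableOn_rectangle (hF : IntegrableOn F (rectangle s t)) :
    Integrable (fun p : ℝ × ℝ => F !₂[p.1, p.2])
      ((volume.restrict s).prod (volume.restrict t)) := by
  rw [Measure.prod_restrict, ← Measure.volume_eq_prod]
  exact (measurePreserving_planeOfProd.integrableOn_comp_preimage
    planeOfProd.measurableEmbedding).2 hF

theorem setIntegral_rectangle (hF : IntegrableOn F (rectangle s t)) :
    ∫ x in rectangle s t, F x = ∫ x in s, ∫ y in t, F !₂[x, y] := by
  rw [← measurePreserving_planeOfProd.setIntegral_preimage_emb planeOfProd.measurableEmbedding,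
    planeOfProd_preimage_rectangle, Measure.volume_eq_prod, ← Measure.prod_restrict]
  exact integral_prod _ (integrable_prod_of_integrableOn_rectangle hF)

theorem setIntegral_rectangle_symm (hF : IntegrableOn F (rectangle s t)) :
    ∫ x in rectangle s t, F x = ∫ y in t, ∫ x in s, F !₂[x, y] :=
  (setIntegral_rectangle hF).trans
    (integral_integral_swap (f := fun x y => F !₂[x, y])
      (integrable_prod_of_integrableOn_rectangle hF))

theorem rectangle_closure_subset_closure :
    rectangle (closure s) (closure t) ⊆ closure (rectangle s t) := by
  rw [← planeOfProd_image_prod, ← planeOfProd_image_prod, ← closure_prod_eq]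
  exact image_closure_subset_closure_image continuous_planeOfProd

theorem IsTestFunction.mul_rectangle (hχ : IsTestFunction s χ) (hψ : IsTestFunction t ψ) :
    IsTestFunction (rectangle s t) fun x => χ (x 0) * ψ (x 1) := by
  have hK : IsCompact (rectangle (tsupport χ) (tsupport ψ)) := by
    rw [← planeOfProd_image_prod]
    exact (hχ.hasCompactSupport.isCompact.prod hψ.hasCompactSupport.isCompact).image
      continuous_planeOfProd
  have hsupp : Function.support (fun x : Plane => χ (x 0) * ψ (x 1)) ⊆
      rectangle (tsupport χ) (tsupport ψ) := fun x hx =>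
    ⟨subset_tsupport χ (left_ne_zero_of_mul hx), subset_tsupport ψ (right_ne_zero_of_mul hx)⟩
  exact ⟨(hχ.contDiff.comp (by fun_prop)).mul (hψ.contDiff.comp (by fun_prop)),
    .of_support_subset_isCompact hK hsupp, (closure_minimal hsupp hK.isClosed).trans
      fun x hx => ⟨hχ.tsupport_subset hx.1, hψ.tsupport_subset hx.2⟩⟩

theorem fderiv_mul_single_zero (hχ : Differentiable ℝ χ) (hψ : Differentiable ℝ ψ) (x : Plane) :
    fderiv ℝ (fun x : Plane => χ (x 0) * ψ (x 1)) x (EuclideanSpace.single 0 1) =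
      deriv χ (x 0) * ψ (x 1) := by
  have hproj (i : Fin 2) : HasFDerivAt (fun x : Plane => x i) (EuclideanSpace.proj (𝕜 := ℝ) i) x :=
    (EuclideanSpace.proj (𝕜 := ℝ) i).hasFDerivAt
  have hmul := ((hχ (x 0)).hasDerivAt.comp_hasFDerivAt x (hproj 0)).mul
    ((hψ (x 1)).hasDerivAt.comp_hasFDerivAt x (hproj 1))
  have heq : fderiv ℝ (fun x : Plane => χ (x 0) * ψ (x 1)) x = _ := hmul.fderiv
  rw [heq]
  simp [mul_comm]

theorem integral_mul_mul_rectangle (hF : LocallyIntegrableOn F (rectangle s t))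
    (hχ : IsTestFunction s χ) (hψ : IsTestFunction t ψ) :
    ∫ x, F x * (χ (x 0) * ψ (x 1)) = ∫ x, (∫ y, F !₂[x, y] * ψ y) * χ x := by
  have hχψ := hχ.mul_rectangle hψ
  rw [← hχψ.setIntegral_mul, setIntegral_rectangle (hχψ.integrable_mul hF).integrableOn,
    ← hχ.setIntegral_mul]
  congr with x
  rw [← hψ.setIntegral_mul, ← integral_mul_const]
  congr with y
  change F !₂[x, y] * (χ x * ψ y) = F !₂[x, y] * ψ y * χ x
  ring

end Rectangle

theorem continuousOn_setIntegral_of_isCompact {X Y : Type*} [TopologicalSpace X]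
    [FirstCountableTopology X] [TopologicalSpace Y] [T2Space Y] [MeasurableSpace Y] [BorelSpace Y]
    {μ : Measure Y} [IsFiniteMeasureOnCompacts μ] {K : Set X} {L : Set Y} {F : X → Y → ℝ}
    (hK : IsCompact K) (hL : IsCompact L) (hF : ContinuousOn (Function.uncurry F) (K ×ˢ L)) :
    ContinuousOn (fun x => ∫ y in L, F x y ∂μ) K := by
  obtain ⟨B, hB⟩ := (hK.prod hL).exists_bound_of_continuousOn hF
  have hsection {x : X} (hx : x ∈ K) : ContinuousOn (F x) L :=
    hF.comp (by fun_prop : ContinuousOn (fun y => (x, y)) L) fun y hy => ⟨hx, hy⟩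
  refine continuousOn_of_dominated (bound := fun _ => B) (fun x hx => ?_) (fun x hx => ?_) ?_ ?_
  · exact ((hsection hx).integrableOn_compact hL).aestronglyMeasurable
  · exact (ae_restrict_iff' hL.measurableSet).2 (.of_forall fun y hy => hB (x, y) ⟨hx, hy⟩)
  · exact integrableOn_const hL.measure_ne_top
  · exact (ae_restrict_iff' hL.measurableSet).2 (.of_forall fun y hy =>
      hF.comp (by fun_prop : ContinuousOn (fun x => (x, y)) K) fun x hx => ⟨hx, hy⟩)

section Green

variable {a b c d : ℝ} {s t : Set ℝ} {v g : Plane → ℝ} {ψ : ℝ → ℝ}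

theorem continuousOn_integral_mul_isTestFunction
    (hv : ContinuousOn v (rectangle (Set.Icc a b) s)) (hψ : IsTestFunction s ψ) :
    ContinuousOn (fun x => ∫ y, v !₂[x, y] * ψ y) (Set.Icc a b) := by
  have hsupp (x : ℝ) : ∫ y in tsupport ψ, v !₂[x, y] * ψ y = ∫ y, v !₂[x, y] * ψ y :=
    setIntegral_eq_integral_of_forall_compl_eq_zero fun y hy => by
      rw [image_eq_zero_of_notMem_tsupport hy, mul_zero]
  simp only [← hsupp]
  refine continuousOn_setIntegral_of_isCompact isCompact_Icc hψ.hasCompactSupport ?_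
  refine (hv.comp continuous_planeOfProd.continuousOn fun p hp => ?_).mul
    (hψ.contDiff.continuous.comp continuous_snd).continuousOn
  exact ⟨hp.1, hψ.tsupport_subset hp.2⟩

theorem integrableOn_mul_isTestFunction (hg : IntegrableOn g (rectangle s t))
    (hψ : IsTestFunction t ψ) : IntegrableOn (fun x => g x * ψ (x 1)) (rectangle s t) := by
  obtain ⟨B, hB⟩ := hψ.hasCompactSupport.exists_bound_of_continuous hψ.contDiff.continuous
  exact hg.mul_bdd (c := B) (hψ.contDiff.continuous.comp (by fun_prop)).aestronglyMeasurable
    (.of_forall fun x => hB _)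

theorem integrableOn_integral_mul_isTestFunction (hg : IntegrableOn g (rectangle s t))
    (hψ : IsTestFunction t ψ) : IntegrableOn (fun x => ∫ y, g !₂[x, y] * ψ y) s := by
  have hint := (integrable_prod_of_integrableOn_rectangle
    (integrableOn_mul_isTestFunction hg hψ)).integral_prod_left
  change IntegrableOn (fun x => ∫ y in t, g !₂[x, y] * ψ y) s at hint
  simpa only [hψ.setIntegral_mul] using hint

theorem integral_setIntegral_mul_isTestFunction (hg : IntegrableOn g (rectangle s t))
    (hψ : IsTestFunction t ψ) :
    ∫ y, (∫ x in s, g !₂[x, y]) * ψ y = ∫ x in s, ∫ y, g !₂[x, y] * ψ y := by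
  have hgψ := integrableOn_mul_isTestFunction hg hψ
  have hswap := (setIntegral_rectangle_symm hgψ).symm.trans (setIntegral_rectangle hgψ)
  change ∫ y in t, ∫ x in s, g !₂[x, y] * ψ y = ∫ x in s, ∫ y in t, g !₂[x, y] * ψ y at hswap
  simpa only [integral_mul_const, hψ.setIntegral_mul] using hswap

theorem IsWeakPartial.setIntegral_integral_mul_eq_sub (hab : a < b)
    (hv : ContinuousOn v (rectangle (Set.Icc a b) (Set.Ioo c d)))
    (hg : IntegrableOn g (rectangle (Set.Ioo a b) (Set.Ioo c d)))
    (h : IsWeakPartial (rectangle (Set.Ioo a b) (Set.Ioo c d)) 0 v g)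
    (hψ : IsTestFunction (Set.Ioo c d) ψ) :
    ∫ x in Set.Ioo a b, ∫ y, g !₂[x, y] * ψ y =
      (∫ y, v !₂[b, y] * ψ y) - ∫ y, v !₂[a, y] * ψ y := by
  have hint : IntervalIntegrable (fun x => ∫ y, g !₂[x, y] * ψ y) volume a b :=
    (intervalIntegrable_iff_integrableOn_Ioo_of_le hab.le).2
      (integrableOn_integral_mul_isTestFunction hg hψ)
  rw [← integral_Ioc_eq_integral_Ioo, ← intervalIntegral.integral_of_le hab.le]
  refine integral_eq_sub_of_integral_mul_deriv_eq_neg hab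
    (continuousOn_integral_mul_isTestFunction hv hψ) hint fun χ hχ => ?_
  have hweak := h.integral_mul_fderiv (hχ.mul_rectangle hψ)
  simp only [fderiv_mul_single_zero (hχ.contDiff.differentiable (by simp))
    (hψ.contDiff.differentiable (by simp))] at hweak
  rwa [integral_mul_mul_rectangle h.1 hχ.deriv hψ,
    integral_mul_mul_rectangle h.2.1 hχ hψ] at hweak

theorem IsWeakPartial.ae_setIntegral_eq_sub (hab : a < b)
    (hv : ContinuousOn v (rectangle (Set.Icc a b) (Set.Ioo c d)))
    (hg : IntegrableOn g (rectangle (Set.Ioo a b) (Set.Ioo c d)))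
    (h : IsWeakPartial (rectangle (Set.Ioo a b) (Set.Ioo c d)) 0 v g) :
    ∀ᵐ y, y ∈ Set.Ioo c d → ∫ x in Set.Ioo a b, g !₂[x, y] = v !₂[b, y] - v !₂[a, y] := by
  have hside {x : ℝ} (hx : x ∈ Set.Icc a b) :
      LocallyIntegrableOn (fun y => v !₂[x, y]) (Set.Ioo c d) :=
    (hv.comp (continuous_planeOfProd.comp (by fun_prop : Continuous fun y => (x, y))).continuousOn
      fun y hy => ⟨hx, hy⟩).locallyIntegrableOn measurableSet_Ioo
  have hva := hside (Set.left_mem_Icc.2 hab.le)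
  have hvb := hside (Set.right_mem_Icc.2 hab.le)
  have hslice : IntegrableOn (fun y => ∫ x in Set.Ioo a b, g !₂[x, y]) (Set.Ioo c d) :=
    (integrable_prod_of_integrableOn_rectangle hg).integral_prod_right
  have hae := ae_eq_zero_of_integral_mul_isTestFunction isOpen_Ioo
    (hslice.locallyIntegrableOn.sub (hvb.sub hva)) fun ψ hψ => by
      have hdiff : Integrable fun y => v !₂[b, y] * ψ y - v !₂[a, y] * ψ y :=
        (hψ.integrable_mul hvb).sub (hψ.integrable_mul hva)
      simp only [Pi.sub_apply, sub_mul]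
      rw [integral_sub (hψ.integrable_mul hslice.locallyIntegrableOn) hdiff,
        integral_sub (hψ.integrable_mul hvb) (hψ.integrable_mul hva),
        integral_setIntegral_mul_isTestFunction hg hψ,
        h.setIntegral_integral_mul_eq_sub hab hv hg hψ, sub_self]
  exact hae.mono fun y hy hycd => sub_eq_zero.1 (hy hycd)

theorem IsWeakPartial.setIntegral_rectangle (hab : a < b)
    (hv : ContinuousOn v (rectangle (Set.Icc a b) (Set.Ioo c d)))
    (hg : IntegrableOn g (rectangle (Set.Ioo a b) (Set.Ioo c d)))
    (h : IsWeakPartial (rectangle (Set.Ioo a b) (Set.Ioo c d)) 0 v g) :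
    ∫ x in rectangle (Set.Ioo a b) (Set.Ioo c d), g x =
      ∫ y in Set.Ioo c d, (v !₂[b, y] - v !₂[a, y]) := by
  rw [setIntegral_rectangle_symm hg]
  exact setIntegral_congr_ae measurableSet_Ioo (h.ae_setIntegral_eq_sub hab hv hg)

end Green

/-! ### Traces on vertical segments -/

theorem tendsto_integral_of_tendsto_eLpNorm {α : Type*} [MeasurableSpace α] {μ : Measure α}
    [IsFiniteMeasure μ] {p : ENNReal} (hp : 1 ≤ p) {f : ℕ → α → ℝ} {f₀ : α → ℝ}
    (hf : ∀ k, Integrable (f k) μ) (hf₀ : AEStronglyMeasurable f₀ μ)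
    (h : Tendsto (fun k => eLpNorm (f k - f₀) p μ) atTop (𝓝 0)) :
    Tendsto (fun k => ∫ x, f k x ∂μ) atTop (𝓝 (∫ x, f₀ x ∂μ)) := by
  refine tendsto_integral_of_L1' f₀ hf₀ (.of_forall hf) ?_
  have hC : μ Set.univ ^ (1 / (1 : ENNReal).toReal - 1 / p.toReal) ≠ ⊤ := by
    refine ENNReal.rpow_ne_top_of_nonneg (sub_nonneg.2 ?_) (measure_ne_top _ _)
    simp only [one_div, ← ENNReal.toReal_inv]
    exact ENNReal.toReal_mono (by simp) (ENNReal.inv_le_inv.2 hp)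
  have hlim := ENNReal.Tendsto.mul_const h (Or.inr hC)
  rw [zero_mul] at hlim
  exact tendsto_of_tendsto_of_tendsto_of_le_of_le tendsto_const_nhds hlim (fun _ => zero_le)
    fun k => eLpNorm_le_eLpNorm_mul_rpow_measure_univ hp ((hf k).aestronglyMeasurable.sub hf₀)

theorem isometry_vertical (a : ℝ) : Isometry fun y : ℝ => (!₂[a, y] : Plane) := by
  refine Isometry.of_dist_eq fun x y => ?_
  rw [EuclideanSpace.dist_eq, Fin.sum_univ_two]
  simp [Real.dist_eq, Real.sqrt_sq_eq_abs]

theorem eLpNorm_vertical_le {Γ : Set Plane} {t : Set ℝ} (hΓ : MeasurableSet Γ) {a : ℝ}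
    (h : ∀ y ∈ t, !₂[a, y] ∈ Γ) (f : Plane → ℝ) (p : ENNReal) :
    eLpNorm (fun y => f !₂[a, y]) p (volume.restrict t) ≤
      eLpNorm f p ((Measure.hausdorffMeasure 1).restrict Γ) := by
  have hemb : MeasurableEmbedding fun y : ℝ => (!₂[a, y] : Plane) :=
    (isometry_vertical a).isClosedEmbedding.measurableEmbedding
  calc eLpNorm (fun y => f !₂[a, y]) p (volume.restrict t)
      ≤ eLpNorm (fun y => f !₂[a, y]) p
          (volume.restrict ((fun y : ℝ => (!₂[a, y] : Plane)) ⁻¹' Γ)) :=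
        eLpNorm_mono_measure _ (Measure.restrict_mono h le_rfl)
    _ = eLpNorm f p ((Measure.map (fun y : ℝ => (!₂[a, y] : Plane)) volume).restrict Γ) := by
        rw [Measure.restrict_map hemb.measurable hΓ, hemb.eLpNorm_map_measure]
        rfl
    _ ≤ eLpNorm f p ((Measure.hausdorffMeasure 1).restrict Γ) := by
        rw [← hausdorffMeasure_real, (isometry_vertical a).map_hausdorffMeasure (by simp)]
        exact eLpNorm_mono_measure f (Measure.restrict_mono_measure Measure.restrict_le_self _)

section Trace

variable {U Γ : Set Plane} {a b c d : ℝ} {u φ : Plane → ℝ}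

theorem tendsto_setIntegral_weakPartial (hU : IsOpen U) (hUfin : volume U ≠ ⊤) {R : Set Plane}
    (hRU : R ⊆ U) {v : ℕ → Plane → ℝ} (hv : ∀ k, MemW12 U (v k)) (hu : MemW12 U u) {i : Fin 2}
    (hvu : Tendsto (fun k => eLpNorm (weakPartial U i (v k - u)) 2 (volume.restrict U))
      atTop (𝓝 0)) :
    Tendsto (fun k => ∫ x in R, weakPartial U i (v k) x) atTop
      (𝓝 (∫ x in R, weakPartial U i u x)) := by
  have : IsFiniteMeasure (volume.restrict R) :=
    isFiniteMeasure_restrict.2 (measure_ne_top_of_subset hRU hUfin)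
  have hRle : volume.restrict R ≤ volume.restrict U := Measure.restrict_mono hRU le_rfl
  have hmem {w : Plane → ℝ} (hw : MemW12 U w) :
      Integrable (weakPartial U i w) (volume.restrict R) :=
    ((hw.memLp_weakPartial hU i).mono_measure hRle).integrable one_le_two
  refine tendsto_integral_of_tendsto_eLpNorm one_le_two (fun k => hmem (hv k))
    (hmem hu).aestronglyMeasurable ?_
  refine tendsto_of_tendsto_of_tendsto_of_le_of_le tendsto_const_nhds hvu (fun _ => zero_le)
    fun k => ?_
  dsimp only
  rw [eLpNorm_congr_ae ((hv k).weakPartial_sub_ae_eq hU hu i)]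
  exact eLpNorm_mono_measure _ hRle

theorem tendsto_setIntegral_vertical {t : Set ℝ} (ht : volume t ≠ ⊤) (hΓ : MeasurableSet Γ)
    (ha : ∀ y ∈ t, !₂[a, y] ∈ Γ) (hφ : Measurable φ) {v : ℕ → Plane → ℝ}
    (hv : ∀ k, IntegrableOn (fun y => v k !₂[a, y]) t)
    (hvφ : Tendsto (fun k => eLpNorm (v k - φ) 2 ((Measure.hausdorffMeasure 1).restrict Γ))
      atTop (𝓝 0)) :
    Tendsto (fun k => ∫ y in t, v k !₂[a, y]) atTop (𝓝 (∫ y in t, φ !₂[a, y])) := by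
  have : IsFiniteMeasure (volume.restrict t) := isFiniteMeasure_restrict.2 ht
  have hφa : Measurable fun y : ℝ => φ !₂[a, y] :=
    hφ.comp (isometry_vertical a).continuous.measurable
  refine tendsto_integral_of_tendsto_eLpNorm one_le_two hv hφa.aestronglyMeasurable ?_
  exact tendsto_of_tendsto_of_tendsto_of_le_of_le tendsto_const_nhds hvφ (fun _ => zero_le)
    fun k => eLpNorm_vertical_le hΓ ha (v k - φ) 2

theorem HasTrace.setIntegral_weakPartial_rectangle (hU : IsOpen U) (hUfin : volume U ≠ ⊤)
    (hab : a < b) (hRU : rectangle (Set.Ioo a b) (Set.Ioo c d) ⊆ U) (hΓ : MeasurableSet Γ)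
    (ha : ∀ y ∈ Set.Ioo c d, !₂[a, y] ∈ Γ) (hb : ∀ y ∈ Set.Ioo c d, !₂[b, y] ∈ Γ)
    (hφ : Measurable φ) (hu : MemW12 U u) (htr : HasTrace U Γ u φ) :
    ∫ x in rectangle (Set.Ioo a b) (Set.Ioo c d), weakPartial U 0 u x =
      (∫ y in Set.Ioo c d, φ !₂[b, y]) - ∫ y in Set.Ioo c d, φ !₂[a, y] := by
  obtain ⟨v, hv, ⟨-, hvu⟩, hvφ⟩ := htr
  have hclosure : rectangle (Set.Icc a b) (closure (Set.Ioo c d)) ⊆ closure U := by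
    rw [← closure_Ioo hab.ne]
    exact rectangle_closure_subset_closure.trans (closure_mono hRU)
  have hvint (k : ℕ) {x : ℝ} (hx : x ∈ Set.Icc a b) :
      IntegrableOn (fun y => v k !₂[x, y]) (Set.Ioo c d) :=
    (((hv k).2.comp (isometry_vertical x).continuous.continuousOn
      fun y hy => hclosure ⟨hx, hy⟩).integrableOn_compact
        (Metric.isBounded_Ioo c d).isCompact_closure).mono_set subset_closure
  have hva := fun k => hvint k (Set.left_mem_Icc.2 hab.le)
  have hvb := fun k => hvint k (Set.right_mem_Icc.2 hab.le)
  have hgreen (k : ℕ) : ∫ x in rectangle (Set.Ioo a b) (Set.Ioo c d), weakPartial U 0 (v k) x =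
      (∫ y in Set.Ioo c d, v k !₂[b, y]) - ∫ y in Set.Ioo c d, v k !₂[a, y] := by
    have hgk : IntegrableOn (weakPartial U 0 (v k)) U :=
      have : IsFiniteMeasure (volume.restrict U) := isFiniteMeasure_restrict.2 hUfin
      ((hv k).1.memLp_weakPartial hU 0).integrable one_le_two
    rw [← integral_sub (hvb k) (hva k)]
    exact (((hv k).1.isWeakPartial 0).mono hRU).setIntegral_rectangle hab
      ((hv k).2.mono fun x hx => hclosure ⟨hx.1, subset_closure hx.2⟩) (hgk.mono_set hRU)
  have hIoo : volume (Set.Ioo c d) ≠ ⊤ := measure_Ioo_lt_top.ne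
  refine tendsto_nhds_unique
    (tendsto_setIntegral_weakPartial hU hUfin hRU (fun k => (hv k).1) hu (hvu 0)) ?_
  simp only [hgreen]
  exact (tendsto_setIntegral_vertical hIoo hΓ hb hφ hvb hvφ).sub
    (tendsto_setIntegral_vertical hIoo hΓ ha hφ hva hvφ)

end Trace

/-! ### The energy of a tangent vector field grows linearly -/

theorem two_mul_integral_sub_le {α : Type*} [MeasurableSpace α] {μ : Measure α}
    [IsFiniteMeasure μ] {g : α → ℝ} (hg : MemLp g 2 μ) (c : ℝ) :
    2 * c * ∫ x, g x ∂μ - c ^ 2 * μ.real Set.univ ≤ ∫ x, g x ^ 2 ∂μ := by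
  have hg1 : Integrable g μ := hg.integrable one_le_two
  calc 2 * c * ∫ x, g x ∂μ - c ^ 2 * μ.real Set.univ = ∫ x, (2 * c * g x - c ^ 2) ∂μ := by
        rw [integral_sub (hg1.const_mul _) (integrable_const _), integral_const_mul,
          integral_const, smul_eq_mul, mul_comm (c ^ 2)]
    _ ≤ ∫ x, g x ^ 2 ∂μ :=
        integral_mono ((hg1.const_mul _).sub (integrable_const _)) hg.integrable_sq fun x => by
          linarith [sq_nonneg (g x - c)]

section LowerBound

variable {δ σ : ℝ} {x : Plane} {n : Plane → Plane}

theorem rectangle_subset_stadium (δ : ℝ) :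
    rectangle (Set.Ioo (-1) 1) (Set.Ioo (-(δ - 1)) (δ - 1)) ⊆ stadium δ := by
  rintro x ⟨⟨h1, h2⟩, h3, h4⟩
  refine ⟨Or.inr ⟨abs_lt.2 ⟨h1, h2⟩, abs_le.2 ⟨by linarith, by linarith⟩⟩, ?_⟩
  simp only [Set.mem_union, M₄, M₅, Set.mem_ofPred_eq, not_or, not_le]
  constructor <;> nlinarith [sq_nonneg (x 0)]

theorem mem_outerBoundary_of_abs_eq_one (hδ : 0 < δ) (hx₀ : |x 0| = 1) (hx₁ : |x 1| ≤ δ) :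
    x ∈ outerBoundary δ := by
  refine ⟨?_, fun hx => ?_⟩
  · have hx : x ∈ rectangle (closure (Set.Ioo (-1) 1)) (closure (Set.Ioo (-δ) δ)) := by
      rw [closure_Ioo (by norm_num), closure_Ioo (by linarith)]
      exact ⟨abs_le.1 hx₀.le, abs_le.1 hx₁⟩
    exact closure_mono (fun y hy => .inr ⟨abs_lt.2 hy.1, (abs_lt.2 hy.2).le⟩)
      (rectangle_closure_subset_closure hx)
  · have hlt : ‖clockwiseTangent δ x‖ < 1 := (fullStadium_eq hδ.le).subset (interior_subset hx)
    rw [← sq_lt_one_iff₀ (norm_nonneg _), norm_sq_clockwiseTangent_of_abs_le hx₁, ← sq_abs, hx₀]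
      at hlt
    norm_num at hlt

theorem setIntegral_weakPartial_of_mem_tangentVectorFields (hδ : 1 ≤ δ)
    (hn : n ∈ tangentVectorFields δ σ) :
    ∫ x in rectangle (Set.Ioo (-1) 1) (Set.Ioo (-(δ - 1)) (δ - 1)),
      weakPartial (stadium δ) 0 (fun x => n x 1) x = -4 * σ * (δ - 1) := by
  have hδ0 : 0 < δ := by linarith
  have hside {a : ℝ} (ha : |a| = 1) :
      ∀ y ∈ Set.Ioo (-(δ - 1)) (δ - 1), !₂[a, y] ∈ outerBoundary δ := fun y hy =>
    mem_outerBoundary_of_abs_eq_one hδ0 ha <| (abs_lt.2 hy).le.trans (sub_le_self δ zero_le_one)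
  have htangent : Measurable fun x => σ * clockwiseTangent δ x 1 :=
    (((EuclideanSpace.proj 1).continuous.comp
      (lipschitzWith_clockwiseTangent δ).continuous).const_mul σ).measurable
  rw [(hn.2.2 1).setIntegral_weakPartial_rectangle (isOpen_stadium hδ0.le)
    (isBounded_stadium hδ0.le).measure_lt_top.ne (by norm_num) (rectangle_subset_stadium δ)
    isClosed_frontier.measurableSet (hside (by simp)) (hside (by simp)) htangent (hn.1 1)]
  simp only [clockwiseTangent, Matrix.cons_val_zero, Matrix.cons_val_one, setIntegral_const,
    Real.volume_real_Ioo_of_le (show -(δ - 1) ≤ δ - 1 by linarith), smul_eq_mul]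
  ring

theorem le_dirichlet_of_mem_tangentVectorFields (hδ : 1 ≤ δ) (hσ : |σ| = 1)
    (hn : n ∈ tangentVectorFields δ σ) :
    4 * (δ - 1) ≤ dirichlet (stadium δ) fun x a => n x a := by
  set R := rectangle (Set.Ioo (-1) 1) (Set.Ioo (-(δ - 1)) (δ - 1)) with hR
  have hRS : R ⊆ stadium δ := rectangle_subset_stadium δ
  have hδ0 : 0 ≤ δ := by linarith
  have hRfin : IsFiniteMeasure (volume.restrict R) := isFiniteMeasure_restrict.2
    (measure_ne_top_of_subset hRS (isBounded_stadium hδ0).measure_lt_top.ne)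
  have hL2 (a i : Fin 2) : MemLp (weakPartial (stadium δ) i fun x => n x a) 2
      (volume.restrict (stadium δ)) := (hn.1 a).memLp_weakPartial (isOpen_stadium hδ0) i
  have hvol : volume.real R = 4 * (δ - 1) := by
    rw [hR, volume_real_rectangle, Real.volume_real_Ioo_of_le (by norm_num),
      Real.volume_real_Ioo_of_le (by linarith)]
    ring
  have hσ2 : σ ^ 2 = 1 := by rw [← sq_abs, hσ, one_pow]
  calc 4 * (δ - 1) = 2 * -σ * (-4 * σ * (δ - 1)) - (-σ) ^ 2 * (4 * (δ - 1)) := by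
        linear_combination -4 * (δ - 1) * hσ2
    _ ≤ ∫ x in R, weakPartial (stadium δ) 0 (fun x => n x 1) x ^ 2 := by
        have h := two_mul_integral_sub_le
          ((hL2 1 0).mono_measure (Measure.restrict_mono hRS le_rfl)) (-σ)
        rwa [measureReal_restrict_apply_univ, hvol,
          setIntegral_weakPartial_of_mem_tangentVectorFields hδ hn] at h
    _ ≤ ∫ x in stadium δ, weakPartial (stadium δ) 0 (fun x => n x 1) x ^ 2 :=
        setIntegral_mono_set (hL2 1 0).integrable_sq (.of_forall fun x => sq_nonneg _)
          hRS.eventuallyLE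
    _ ≤ dirichlet (stadium δ) fun x a => n x a := by
        refine integral_mono (hL2 1 0).integrable_sq (integrable_finsetSum _ fun a _ =>
          integrable_finsetSum _ fun i _ => (hL2 a i).integrable_sq) fun x => ?_
        exact (Finset.single_le_sum (fun i _ => sq_nonneg
            (weakPartial (stadium δ) i (fun y => n y 1) x)) (Finset.mem_univ 0)).trans
          (Finset.single_le_sum
            (f := fun a => ∑ i, weakPartial (stadium δ) i (fun y => n y a) x ^ 2)
            (fun a _ => Finset.sum_nonneg fun i _ => sq_nonneg _) (Finset.mem_univ 1))

theorem le_vectorEnergy_of_mem_tangentVectorFields (s : ℝ) (hδ : 1 ≤ δ) (hσ : |σ| = 1)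
    (hn : n ∈ tangentVectorFields δ σ) : 8 * (δ - 1) * s ^ 2 ≤ vectorEnergy s δ n := by
  calc 8 * (δ - 1) * s ^ 2 = 2 * s ^ 2 * (4 * (δ - 1)) := by ring
    _ ≤ vectorEnergy s δ n := by
      rw [vectorEnergy]
      gcongr
      exact le_dirichlet_of_mem_tangentVectorFields hδ hσ hn

end LowerBound

end LineField

open LineField in
theorem mainTheorem8_general :
    ∃ δ₀ : ℝ, 1 < δ₀ ∧ ∀ δ : ℝ, δ₀ < δ → ∀ s : ℝ, s ≠ 0 → ∀ σ : ℝ, (σ = 1 ∨ σ = -1) →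
      (tangentLineFields s δ).Nonempty ∧
      (tangentVectorFields δ σ).Nonempty ∧
      sInf (lineEnergy δ '' tangentLineFields s δ) <
        sInf (vectorEnergy s δ '' tangentVectorFields δ σ) ∧
      ∀ Q ∈ tangentLineFields s δ, IsMinOn (lineEnergy δ) (tangentLineFields s δ) Q →
      ∀ n ∈ tangentVectorFields δ σ, IsMinOn (vectorEnergy s δ) (tangentVectorFields δ σ) n →
        lineEnergy δ Q < vectorEnergy s δ n := by
  set K : ℝ := 9216 * volume.real (Metric.closedBall (0 : Plane) 1)
  have hK0 : 0 ≤ K := by positivity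
  refine ⟨2 + K, by linarith, fun δ hδ s hs σ hσ => ?_⟩
  replace hσ : |σ| = 1 := (abs_eq zero_le_one).2 hσ
  have hQ := tangentLineField_mem_tangentLineFields (δ := δ) s (by linarith)
  have hn := tangentVectorField_mem_tangentVectorFields (δ := δ) (by linarith) hσ
  have hupper : lineEnergy δ (tangentLineField s δ) ≤ K * s ^ 2 :=
    lineEnergy_tangentLineField_le s (by linarith)
  have hlower (n) (hn : n ∈ tangentVectorFields δ σ) : 8 * (δ - 1) * s ^ 2 ≤ vectorEnergy s δ n :=
    le_vectorEnergy_of_mem_tangentVectorFields s (by linarith) hσ hn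
  have hgap : K * s ^ 2 < 8 * (δ - 1) * s ^ 2 := by
    gcongr
    linarith
  refine ⟨⟨_, hQ⟩, ⟨_, hn⟩, ?_, fun Q _ hQmin n hn _ =>
    ((hQmin hQ).trans hupper).trans_lt (hgap.trans_le (hlower n hn))⟩
  calc sInf (lineEnergy δ '' tangentLineFields s δ)
      ≤ lineEnergy δ (tangentLineField s δ) :=
        csInf_le ⟨0, Set.forall_mem_image.2 fun Q _ => dirichlet_nonneg _ _⟩
          (Set.mem_image_of_mem _ hQ)
    _ ≤ K * s ^ 2 := hupper
    _ < 8 * (δ - 1) * s ^ 2 := hgap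
    _ ≤ sInf (vectorEnergy s δ '' tangentVectorFields δ σ) :=
        le_csInf (.image _ ⟨_, hn⟩) (Set.forall_mem_image.2 hlower)

theorem mainTheorem8 (s : ℝ) (hs : s ∈ Set.Icc (-(1 / 2) : ℝ) 1) (hs0 : s ≠ 0) :
    ∃ δ₀ : ℝ, 1 < δ₀ ∧ ∀ δ : ℝ, δ₀ < δ → ∀ σ : ℝ, (σ = 1 ∨ σ = -1) →
      (LineField.tangentLineFields s δ).Nonempty ∧
      (LineField.tangentVectorFields δ σ).Nonempty ∧
      sInf (LineField.lineEnergy δ '' LineField.tangentLineFields s δ) <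
        sInf (LineField.vectorEnergy s δ '' LineField.tangentVectorFields δ σ) ∧
      ∀ Q ∈ LineField.tangentLineFields s δ,
        IsMinOn (LineField.lineEnergy δ) (LineField.tangentLineFields s δ) Q →
      ∀ n ∈ LineField.tangentVectorFields δ σ,
        IsMinOn (LineField.vectorEnergy s δ) (LineField.tangentVectorFields δ σ) n →
          LineField.lineEnergy δ Q < LineField.vectorEnergy s δ n := by
  obtain ⟨δ₀, hδ₀, h⟩ := mainTheorem8_general
  exact ⟨δ₀, hδ₀, fun δ hδ => h δ hδ s hs0⟩
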